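/- Let $n\ge 1$, let $H_n$ be an $n$-dimensional complex Hilbert space with orthonormal basis $e_1,\dots,e_n$, let $F^2(H_n)=\bigoplus_{k\ge 0}H_n^{\otimes k}$ be the full Fock space with orthonormal basis $e_\alpha=e_{i_1}\otimes\cdots\otimes e_{i_k}$, $\alpha=g_{i_1}\cdots g_{i_k}\in\mathbb F_n^+$ (the free monoid on $g_1,\dots,g_n$, with identity $g_0$ and $e_{g_0}=1$), and let $S_i\varphi=e_i\otimes\varphi$, $R_i\varphi=\varphi\otimes e_i$ be the left and right creation operators, $S_\alpha=S_{i_1}\cdots S_{i_k}$, $S_{g_0}=I$. Let $\mathcal E$ be a complex Hilbert space. An operator $A\in B(\mathcal E\otimes F^2(H_n))$ is multi-Toeplitz if $(I\otimes R_i^*)A(I\otimes R_j)=\delta_{ij}A$ for all $i,j$. The Fourier representation of such an $A$ is the formal series $\sum_{|\alpha|\ge1}B_{(\alpha)}\otimes S_\alpha^*+A_{(0)}\otimes I+\sum_{|\alpha|\ge1}A_{(\alpha)}\otimes S_\alpha$ with $\langle A_{(\alpha)}x,y\rangle=\langle A(x\otimes1),y\otimes e_\alpha\rangle$ for all $\alpha$,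 $\langle B_{(\alpha)}x,y\rangle=\langle A(x\otimes e_\alpha),y\otimes 1\rangle$ for $\alpha\ne g_0$ ($x,y\in\mathcal E$), and $A_{(0)}=A_{(g_0)}$. Let $\mathcal A_n$ be the norm closed algebra generated by $S_1,\dots,S_n$ and $I$, let $\mathcal A_n(\mathcal E)=B(\mathcal E)\otimes_{\min}\mathcal A_n$ be the operator norm closure in $B(\mathcal E\otimes F^2(H_n))$ of the span of the operators $X\otimes Y$, $X\in B(\mathcal E)$, $Y\in\mathcal A_n$, and let $\mathcal E\otimes\mathcal P$ be the space of finite sums $\sum h_\alpha\otimes e_\alpha$, $h_\alpha\in\mathcal E$. Let $\{A_{(\alpha)}\}_{\alpha\in\mathbb F_n^+}$ and $\{B_{(\alpha)}\}_{\alpha\in\mathbb F_n^+\setminus\{g_0\}}$ be two families in $B(\mathcal E)$, and for $0\le r<1$ put $$\varphi(rS_1,\dots,rS_n)=\sum_{k=1}^\infty\sum_{|\alpha|=k}B_{(\alpha)}\otimes r^{|\alpha|}S_\alpha^*+A_{(0)}\otimes I+\sum_{k=1}^\infty\sum_{|\alpha|=k}A_{(\alpha)}\otimes r^{|\alpha|}S_\alpha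 .$$ Then $\varphi(S_1,\dots,S_n)=\sum_{|\alpha|\ge1}B_{(\alpha)}\otimes S_\alpha^*+A_{(0)}\otimes I+\sum_{|\alpha|\ge1}A_{(\alpha)}\otimes S_\alpha$ is the Fourier representation of a multi-Toeplitz operator $A\in B(\mathcal E\otimes F^2(H_n))$ if and only if (i) $\sum_{|\alpha|\ge1}A_{(\alpha)}^*A_{(\alpha)}$ and $\sum_{|\alpha|\ge1}B_{(\alpha)}B_{(\alpha)}^*$ converge in the weak operator topology (in which case, for $0\le r<1$, the two series over $k$ that define $\varphi(rS_1,\dots,rS_n)$ converge in the operator norm), and (ii) $\sup_{0\le r<1}\|\varphi(rS_1,\dots,rS_n)\|<\infty$. Moreover, in this case, (a) for each $r\in[0,1)$ the series over $k$ that define $\varphi(rS_1,\dots,rS_n)$ converge in the operator norm, and $\varphi(rS_1,\dots,rS_n)\in\mathcal A_n(\mathcal E)^*+\mathcal A_n(\mathcal E)$; (b) $A=\text{SOT-}\lim_{r\to1^-}\varphi(rS_1,\dots,rS_n)$; (c) $\|A\|=\sup_{0\le r<1}\|\varphi(rS_1,\dots,rS_n)\|=\lim_{r\to1^-}\|\varphi(rS_1,\dots,rS_n)\|=\sup_{q\in\mathcal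 E\otimes\mathcal P,\ \|q\|\le1}\|\varphi(S_1,\dots,S_n)q\|$, where $\varphi(S_1,\dots,S_n)q=\sum_{|\alpha|\ge1}(B_{(\alpha)}\otimes S_\alpha^*)q+(A_{(0)}\otimes I)q+\sum_{|\alpha|\ge1}(A_{(\alpha)}\otimes S_\alpha)q$, both series being convergent in $\mathcal E\otimes F^2(H_n)$ for every $q\in\mathcal E\otimes\mathcal P$. -/

import Mathlib

open Filter Topology
open scoped TensorProduct

noncomputable section

namespace MultiToeplitz

/-- The unital free semigroup `𝔽ₙ⁺` on `n` generators; its identity `g₀` is `1`. -/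
abbrev Word (n : ℕ) : Type := FreeMonoid (Fin n)

instance instDecidableEqWord (n : ℕ) : DecidableEq (Word n) :=
  inferInstanceAs (DecidableEq (List (Fin n)))

/-- The finite set of words of length `k`. -/
def wordsOfLength (n k : ℕ) : Finset (Word n) :=
  Finset.univ.image fun w : Fin k → Fin n => FreeMonoid.ofList (List.ofFn w)

theorem mem_wordsOfLength {n k : ℕ} {α : Word n} :
    α ∈ wordsOfLength n k ↔ α.length = k := by
  constructor
  · intro h
    obtain ⟨w, -, rfl⟩ := Finset.mem_image.1 h
    exact List.length_ofFn
  · rintro rfl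
    exact Finset.mem_image.2 ⟨fun i => α.toList.get i, Finset.mem_univ _,
      congrArg FreeMonoid.ofList (List.ofFn_get α.toList)⟩

/-- The full Fock space `F²(Hₙ)` in its orthonormal basis `(e_α)` indexed by the words `α`:
the word `g_{i₁} ⋯ g_{iₖ}` corresponds to `e_{i₁} ⊗ ⋯ ⊗ e_{iₖ}`, and `1 = g₀` to the vacuum. -/
abbrev Fock (n : ℕ) : Type := lp (fun _ : Word n => ℂ) 2

/-- The basis vector `e_α` of the Fock space. -/
def e {n : ℕ} (α : Word n) : Fock n := lp.single 2 α (1 : ℂ)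

theorem orthonormal_e (n : ℕ) : Orthonormal ℂ (e : Word n → Fock n) := by
  classical
  rw [orthonormal_iff_ite]
  intro α β
  unfold e
  rw [lp.inner_single_left, lp.single_apply, Pi.single_apply]
  split_ifs <;> simp_all

/-- The isometry of the Fock space with `e_α ↦ e_{f α}`, for an injective map `f` of words. -/
def wordIsometry {n : ℕ} (f : Word n → Word n) (hf : Function.Injective f) :
    Fock n →ₗᵢ[ℂ] Fock n :=
  ((orthonormal_e n).comp f hf).orthogonalFamily.linearIsometry

theorem wordIsometry_e {n : ℕ} (f : Word n → Word n) (hf : Function.Injective f) (α : Word n) :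
    wordIsometry f hf (e α) = e (f α) := by
  unfold wordIsometry
  conv_lhs => rw [e]
  rw [OrthogonalFamily.linearIsometry_apply_single]
  simp

/-- The left creation operator `Sᵢ`, `Sᵢ φ = eᵢ ⊗ φ`, that is, `Sᵢ e_α = e_{gᵢ α}`. -/
def S (n : ℕ) (i : Fin n) : Fock n →L[ℂ] Fock n :=
  (wordIsometry (fun α => FreeMonoid.of i * α)
    (fun _ _ h => mul_left_cancel h)).toContinuousLinearMap

theorem S_e {n : ℕ} (i : Fin n) (α : Word n) : S n i (e α) = e (FreeMonoid.of i * α) :=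
  wordIsometry_e _ (fun _ _ h => mul_left_cancel h) α

/-- The right creation operator `Rᵢ`, `Rᵢ φ = φ ⊗ eᵢ`, that is, `Rᵢ e_α = e_{α gᵢ}`. -/
def R (n : ℕ) (i : Fin n) : Fock n →L[ℂ] Fock n :=
  (wordIsometry (fun α => α * FreeMonoid.of i)
    (fun _ _ h => mul_right_cancel h)).toContinuousLinearMap

theorem R_e {n : ℕ} (i : Fin n) (α : Word n) : R n i (e α) = e (α * FreeMonoid.of i) :=
  wordIsometry_e _ (fun _ _ h => mul_right_cancel h) α

/-- `S_α = S_{i₁} ⋯ S_{iₖ}` for `α = g_{i₁} ⋯ g_{iₖ}`, and `S_{g₀} = I`. -/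
def SWord {n : ℕ} (α : Word n) : Fock n →L[ℂ] Fock n := FreeMonoid.lift (S n) α

/-- The noncommutative disc algebra `𝒜ₙ`: the norm closed algebra generated by
`S₁, …, Sₙ` and the identity. -/
def discAlgebra (n : ℕ) : Subalgebra ℂ (Fock n →L[ℂ] Fock n) :=
  (Algebra.adjoin ℂ (Set.range (S n))).topologicalClosure

variable (E : Type*) [NormedAddCommGroup E] [InnerProductSpace ℂ E]

/-- The Hilbert space tensor product `ℰ ⊗ F²(Hₙ)`. -/
abbrev HTensor (n : ℕ) : Type _ := UniformSpace.Completion (E ⊗[ℂ] Fock n)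

variable {E} {n : ℕ}

/-- The elementary tensor `x ⊗ f` in `ℰ ⊗ F²(Hₙ)`. -/
def tens (x : E) (f : Fock n) : HTensor E n := ((x ⊗ₜ[ℂ] f : E ⊗[ℂ] Fock n) : HTensor E n)

/-- The bounded operator `X ⊗ Y` on `ℰ ⊗ F²(Hₙ)`. -/
def opTens (X : E →L[ℂ] E) (Y : Fock n →L[ℂ] Fock n) : HTensor E n →L[ℂ] HTensor E n :=
  (TensorProduct.mapL X Y).completion

theorem opTens_tens (X : E →L[ℂ] E) (Y : Fock n →L[ℂ] Fock n) (x : E) (f : Fock n) :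
    opTens X Y (tens x f) = tens (X x) (Y f) := by
  unfold opTens tens
  simp

variable (E n) in
/-- The operator space `𝒜ₙ(ℰ) = B(ℰ) ⊗_min 𝒜ₙ`, the spatial tensor product: the closure in the
operator norm of `B(ℰ ⊗ F²(Hₙ))` of the span of all `X ⊗ Y`, `X ∈ B(ℰ)`, `Y ∈ 𝒜ₙ`. -/
def discOpSpace : Submodule ℂ (HTensor E n →L[ℂ] HTensor E n) :=
  (Submodule.span ℂ {T | ∃ X : E →L[ℂ] E, ∃ Y ∈ discAlgebra n, T = opTens X Y}).topologicalClosure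

variable (E n) in
/-- The set `𝒜ₙ(ℰ)* + 𝒜ₙ(ℰ)`. -/
def discOpSum : Set (HTensor E n →L[ℂ] HTensor E n) :=
  {T | ∃ P ∈ discOpSpace E n, ∃ Q ∈ discOpSpace E n, T = ContinuousLinearMap.adjoint P + Q}

/-- `T` is multi-Toeplitz with respect to the right creation operators:
`(I ⊗ Rᵢ*) T (I ⊗ Rⱼ) = δᵢⱼ T`. -/
def IsMultiToeplitz (T : HTensor E n →L[ℂ] HTensor E n) : Prop :=
  ∀ i j : Fin n,
    opTens (.id ℂ E) (ContinuousLinearMap.adjoint (R n i)) ∘L T ∘L opTens (.id ℂ E) (R n j) =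
      if i = j then T else 0

/-- `∑_{|α| ≥ 1} B_α ⊗ S_α* + A_0 ⊗ I + ∑_{|α| ≥ 1} A_α ⊗ S_α` is the formal Fourier
representation of `T`: `⟨A_α x, y⟩ = ⟨T (x ⊗ 1), y ⊗ e_α⟩` for all words `α`, and
`⟨B_α x, y⟩ = ⟨T (x ⊗ e_α), y ⊗ 1⟩` for all words `α ≠ g₀`. (Mathlib's inner product is linear in
the second argument. The value of `B` at `g₀` plays no role, here and below.) -/
def IsFourierRepr (A B : Word n → E →L[ℂ] E) (T : HTensor E n →L[ℂ] HTensor E n) : Prop :=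
  (∀ (α : Word n) (x y : E), inner ℂ y (A α x) = inner ℂ (tens y (e α)) (T (tens x (e 1)))) ∧
  (∀ (α : Word n), α ≠ 1 → ∀ x y : E,
    inner ℂ y (B α x) = inner ℂ (tens y (e 1)) (T (tens x (e α))))

/-- The homogeneous part `∑_{|α| = k} A_α ⊗ r^{|α|} S_α`. -/
def posPart (A : Word n → E →L[ℂ] E) (r : ℝ) (k : ℕ) : HTensor E n →L[ℂ] HTensor E n :=
  ∑ α ∈ wordsOfLength n k, opTens (A α) (((r : ℂ) ^ α.length) • SWord α)

/-- The homogeneous part `∑_{|α| = k} B_α ⊗ r^{|α|} S_α*`. -/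
def negPart (B : Word n → E →L[ℂ] E) (r : ℝ) (k : ℕ) : HTensor E n →L[ℂ] HTensor E n :=
  ∑ α ∈ wordsOfLength n k,
    opTens (B α) (((r : ℂ) ^ α.length) • ContinuousLinearMap.adjoint (SWord α))

/-- `φ(rS₁, …, rSₙ)`, both series being taken in the operator norm. -/
def phi (A B : Word n → E →L[ℂ] E) (r : ℝ) : HTensor E n →L[ℂ] HTensor E n :=
  (∑' k : ℕ, negPart B r (k + 1)) + opTens (A 1) (.id ℂ (Fock n)) +
    (∑' k : ℕ, posPart A r (k + 1))

variable (E n) in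
/-- The space `ℰ ⊗ 𝒫` of vector-valued polynomials `∑_{|α| ≤ m} h_α ⊗ e_α`. -/
def polynomials : Submodule ℂ (HTensor E n) :=
  Submodule.span ℂ {v | ∃ (h : E) (α : Word n), v = tens h (e α)}

/-- The terms `(A_α ⊗ S_α) q`, `|α| ≥ 1`. -/
def posTerm (A : Word n → E →L[ℂ] E) (q : HTensor E n) (α : {α : Word n // α ≠ 1}) :
    HTensor E n :=
  opTens (A α) (SWord α.1) q

/-- The terms `(B_α ⊗ S_α*) q`, `|α| ≥ 1`. -/
def negTerm (B : Word n → E →L[ℂ] E) (q : HTensor E n) (α : {α : Word n // α ≠ 1}) :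
    HTensor E n :=
  opTens (B α) (ContinuousLinearMap.adjoint (SWord α.1)) q

/-- The vector `φ(S₁, …, Sₙ) q`, both series being taken in `ℰ ⊗ F²(Hₙ)`. -/
def phiApply (A B : Word n → E →L[ℂ] E) (q : HTensor E n) : HTensor E n :=
  (∑' α, negTerm B q α) + opTens (A 1) (.id ℂ (Fock n)) q + (∑' α, posTerm A q α)

/-- `∑_{|α| ≥ 1} A_α* A_α` and `∑_{|α| ≥ 1} B_α B_α*` converge in the weak operator topology. -/
def WOTConvergent [CompleteSpace E] (A B : Word n → E →L[ℂ] E) : Prop :=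
  Summable (fun α : {α : Word n // α ≠ 1} =>
    ContinuousLinearMapWOT.ofCLM (ContinuousLinearMap.adjoint (A α) ∘L A α)) ∧
  Summable (fun α : {α : Word n // α ≠ 1} =>
    ContinuousLinearMapWOT.ofCLM (B α ∘L ContinuousLinearMap.adjoint (B α)))

end MultiToeplitz

end

noncomputable section

namespace MultiToeplitz

/-! ### Elementary tensors, density of polynomials, creation operators on the word basis -/

section Basics

variable {E : Type*} [NormedAddCommGroup E] [InnerProductSpace ℂ E] {n : ℕ}

/-! Everything is read off the operator matrix in the basis of words. Cancelling common last letters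
shows that the entry of a multi-Toeplitz operator at (β, α) is A_ω if β = ωα, B_ω if α = ωβ with ω ≠
g₀, and 0 if neither word is a suffix of the other (`inner_eq_symbolKernel`). Conversely, a bounded
operator with this matrix is multi-Toeplitz with these coefficients. The matrix of φ(rS₁, …, rSₙ) is
the same one with each entry multiplied by r to the power ||β| - |α|| (`inner_phi`), hence a Schur
product with a scalar kernel.

The kernel r^|j - k| is the Gram matrix of unit vectors (`sum_poissonVector`), so Schur
multiplication by it is contractive and ‖φ(rS₁, …, rSₙ)‖ ≤ ‖A‖ (`opNorm_le_of_damped`). Condition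
(i) holds for every bounded A because the A_α and the B_α* are the coordinates of the vacuum columns
of A and of its adjoint.

Conversely, (i) bounds the columns of coefficients. Prepending different words of one length k
produces orthogonal vectors, so the part of degree k has norm O(r^k) (`norm_posPart_le`), and
adjoints handle the other half. On polynomials φ(rS₁, …, rSₙ)q tends to φ(S₁, …, Sₙ)q by dominated
convergence (`tendsto_phi_polynomial`). A bound uniform in r survives this limit, and φ(S₁, …, Sₙ)
extends by density to the required operator (`exists_isMultiToeplitz_of_bound`). Contractivity and
density then upgrade the limit to a strong one, and lower semicontinuity of the norm gives (c). -/

theorem inner_e (α β : Word n) : inner ℂ (e α) (e β) = if α = β then (1 : ℂ) else 0 :=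
  orthonormal_iff_ite.1 (orthonormal_e n) α β

theorem inner_tens (x y : E) (f g : Fock n) :
    inner ℂ (tens x f) (tens y g) = inner ℂ x y * inner ℂ f g := by
  unfold tens
  rw [UniformSpace.Completion.inner_coe, TensorProduct.inner_tmul]

theorem norm_tens (x : E) (f : Fock n) : ‖tens x f‖ = ‖x‖ * ‖f‖ := by
  unfold tens
  rw [UniformSpace.Completion.norm_coe, TensorProduct.norm_tmul]

theorem tens_add_left (x y : E) (f : Fock n) : tens (x + y) f = tens x f + tens y f := by
  unfold tens
  rw [TensorProduct.add_tmul, UniformSpace.Completion.coe_add]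

theorem tens_smul_left (c : ℂ) (x : E) (f : Fock n) : tens (c • x) f = c • tens x f := by
  unfold tens
  rw [← TensorProduct.smul_tmul', UniformSpace.Completion.coe_smul]

theorem tens_add_right (x : E) (f g : Fock n) : tens x (f + g) = tens x f + tens x g := by
  unfold tens
  rw [TensorProduct.tmul_add, UniformSpace.Completion.coe_add]

theorem tens_smul_right (c : ℂ) (x : E) (f : Fock n) : tens x (c • f) = c • tens x f := by
  unfold tens
  rw [TensorProduct.tmul_smul, UniformSpace.Completion.coe_smul]

theorem tens_zero_left (f : Fock n) : tens (0 : E) f = 0 := by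
  simpa using tens_smul_left 0 (0 : E) f

/-- The isometric embedding `x ↦ x ⊗ e_α`. -/
def embed (α : Word n) : E →ₗᵢ[ℂ] HTensor E n where
  toFun x := tens x (e α)
  map_add' x y := tens_add_left x y _
  map_smul' c x := tens_smul_left c x _
  norm_map' x := by
    change ‖tens x (e α)‖ = ‖x‖
    rw [norm_tens, (orthonormal_e n).1 α, mul_one]

@[simp] theorem embed_apply (α : Word n) (x : E) : embed α x = tens x (e α) := rfl

theorem inner_tens_e (x y : E) (α β : Word n) :
    inner ℂ (tens x (e α)) (tens y (e β)) = if α = β then inner ℂ x y else 0 := by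
  rw [inner_tens, inner_e]
  split_ifs <;> simp

theorem orthogonalFamily_embed :
    OrthogonalFamily ℂ (fun _ : Word n => E) (fun α => (embed α : E →ₗᵢ[ℂ] HTensor E n)) := by
  intro α β hαβ x y
  rw [embed_apply, embed_apply, inner_tens_e, if_neg hαβ]

theorem tens_e_mem_polynomials (x : E) (α : Word n) : tens x (e α) ∈ polynomials E n :=
  Submodule.subset_span ⟨x, α, rfl⟩

/-- The map `f ↦ x ⊗ f` as a bounded operator. -/
def tensRight (x : E) : Fock n →L[ℂ] HTensor E n :=
  LinearMap.mkContinuous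
    { toFun := fun f => tens x f
      map_add' := tens_add_right x
      map_smul' := fun c f => tens_smul_right c x f } ‖x‖ fun f => (norm_tens x f).le

@[simp] theorem tensRight_apply (x : E) (f : Fock n) : tensRight x f = tens x f := rfl

theorem tens_mem_closure_polynomials (x : E) (f : Fock n) :
    tens x f ∈ (polynomials E n).topologicalClosure := by
  have h := (lp.hasSum_single (E := fun _ : Word n => ℂ) (p := 2) (by norm_num) f).mapL
    (tensRight (n := n) x)
  refine Submodule.isClosed_topologicalClosure _ |>.mem_of_tendsto h (Eventually.of_forall ?_)
  intro s
  refine Submodule.sum_mem _ fun α _ => Submodule.le_topologicalClosure _ ?_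
  have : lp.single (E := fun _ : Word n => ℂ) 2 α (f α) = f α • e α := by
    unfold e
    rw [← lp.single_smul, smul_eq_mul, mul_one]
  rw [this, tensRight_apply, tens_smul_right]
  exact Submodule.smul_mem _ _ (tens_e_mem_polynomials x α)

theorem dense_polynomials : Dense (polynomials E n : Set (HTensor E n)) := by
  rw [Submodule.dense_iff_topologicalClosure_eq_top, eq_top_iff]
  rintro h -
  refine UniformSpace.Completion.induction_on h
    (Submodule.isClosed_topologicalClosure (polynomials E n)) fun a => ?_
  induction a using TensorProduct.induction_on with
  | zero => exact Submodule.zero_mem _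
  | tmul x f => exact tens_mem_closure_polynomials x f
  | add a b ha hb =>
    rw [UniformSpace.Completion.coe_add]
    exact Submodule.add_mem _ ha hb

/-- Two bounded operators that agree on the vectors `x ⊗ e_α` are equal. -/
theorem ext_tens {F : Type*} [NormedAddCommGroup F] [NormedSpace ℂ F]
    {P Q : HTensor E n →L[ℂ] F} (h : ∀ (x : E) (α : Word n), P (tens x (e α)) = Q (tens x (e α))) :
    P = Q := by
  refine ContinuousLinearMap.ext_on dense_polynomials ?_
  rintro _ ⟨x, α, rfl⟩
  exact h x α

theorem eq_of_inner_tens {u v : HTensor E n}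
    (h : ∀ (y : E) (β : Word n), inner ℂ (tens y (e β)) u = inner ℂ (tens y (e β)) v) : u = v := by
  have h' : (innerSL ℂ u : HTensor E n →L[ℂ] ℂ) = innerSL ℂ v := by
    refine ext_tens fun y β => ?_
    have := congrArg (starRingEnd ℂ) (h y β)
    simpa only [innerSL_apply_apply, inner_conj_symm] using this
  exact innerSL_inj.1 h'

theorem ext_entries {P Q : HTensor E n →L[ℂ] HTensor E n}
    (h : ∀ (x y : E) (α β : Word n), inner ℂ (tens y (e β)) (P (tens x (e α))) =
      inner ℂ (tens y (e β)) (Q (tens x (e α)))) : P = Q :=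
  ext_tens fun x α => eq_of_inner_tens fun y β => h x y α β

/-- Every vector-valued polynomial is a finite sum `∑ h_α ⊗ e_α`. -/
theorem exists_eq_sum_of_mem_polynomials {q : HTensor E n} (hq : q ∈ polynomials E n) :
    ∃ (s : Finset (Word n)) (h : Word n → E), q = ∑ α ∈ s, tens (h α) (e α) := by
  classical
  suffices H : ∃ f : Word n →₀ E, q = f.sum fun α x => embed α x by
    obtain ⟨f, rfl⟩ := H
    exact ⟨f.support, f, rfl⟩
  induction hq using Submodule.span_induction with
  | mem v hv =>
    obtain ⟨x, α, rfl⟩ := hv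
    exact ⟨Finsupp.single α x, 
      (Finsupp.sum_single_index (h := fun α x => embed (n := n) α x) (map_zero (embed α))).symm⟩
  | zero => exact ⟨0, by simp⟩
  | add u v _ _ hu hv =>
    obtain ⟨f, rfl⟩ := hu
    obtain ⟨g, rfl⟩ := hv
    exact ⟨f + g, by rw [Finsupp.sum_add_index'] <;> simp [tens_add_left, tens_zero_left]⟩
  | smul c u _ hu =>
    obtain ⟨f, rfl⟩ := hu
    refine ⟨c • f, ?_⟩
    rw [Finsupp.sum_smul_index' (fun α => map_zero _), Finsupp.smul_sum]
    simp only [map_smul]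

theorem norm_sq_sum_tens {ι : Type*} (s : Finset ι) (w : ι → Word n) (hw : Set.InjOn w s)
    (h : ι → E) : ‖∑ i ∈ s, tens (h i) (e (w i))‖ ^ 2 = ∑ i ∈ s, ‖h i‖ ^ 2 := by
  classical
  have := ((orthogonalFamily_embed (E := E) (n := n)).comp (γ := s) (f := fun i => w i)
      (fun i j hij => Subtype.ext (hw i.2 j.2 hij))).norm_sum (fun i => h i) Finset.univ
  rw [← Finset.sum_coe_sort s, ← Finset.sum_coe_sort s]
  exact this

theorem norm_sq_polynomial (s : Finset (Word n)) (h : Word n → E) :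
    ‖∑ α ∈ s, tens (h α) (e α)‖ ^ 2 = ∑ α ∈ s, ‖h α‖ ^ 2 :=
  norm_sq_sum_tens s id Function.injective_id.injOn h

/-- A bounded operator is bounded by `C` if its sesquilinear form is, on polynomials. -/
theorem opNorm_le_of_polynomials {P : HTensor E n →L[ℂ] HTensor E n} {C : ℝ} (hC : 0 ≤ C)
    (hP : ∀ h ∈ polynomials E n, ∀ k ∈ polynomials E n, ‖inner ℂ k (P h)‖ ≤ C * ‖h‖ * ‖k‖) :
    ‖P‖ ≤ C := by
  have h1 : ∀ h ∈ polynomials E n, ∀ k : HTensor E n, ‖inner ℂ k (P h)‖ ≤ C * ‖h‖ * ‖k‖ := by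
    intro h hh k
    refine dense_polynomials.induction (P := fun k => ‖inner ℂ k (P h)‖ ≤ C * ‖h‖ * ‖k‖)
      (hP h hh) (isClosed_le (by fun_prop) (by fun_prop)) k
  have h2 : ∀ h ∈ polynomials E n, ‖P h‖ ≤ C * ‖h‖ := by
    intro h hh
    -- Testing against k = P h itself turns the form bound into a bound on ‖P h‖.
    have := h1 h hh (P h)
    rw [inner_self_eq_norm_sq_to_K] at this
    rcases (norm_nonneg (P h)).eq_or_lt with h0 | h0
    · rw [← h0]; positivity
    · refine le_of_mul_le_mul_right ?_ h0
      simpa [sq] using this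
  refine P.opNorm_le_bound hC fun h => ?_
  exact dense_polynomials.induction (P := fun h => ‖P h‖ ≤ C * ‖h‖) h2
    (isClosed_le (by fun_prop) (by fun_prop)) h

theorem opTens_smul (X : E →L[ℂ] E) (c : ℂ) (Y : Fock n →L[ℂ] Fock n) :
    opTens X (c • Y) = c • opTens X Y :=
  ext_tens fun x α => by
    rw [opTens_tens, smul_apply, smul_apply, opTens_tens,
      tens_smul_right]

theorem adjoint_opTens [CompleteSpace E] (X : E →L[ℂ] E) (Y : Fock n →L[ℂ] Fock n) :
    ContinuousLinearMap.adjoint (opTens X Y) =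
      opTens (ContinuousLinearMap.adjoint X) (ContinuousLinearMap.adjoint Y) :=
  ext_entries fun x y α β => by
    rw [ContinuousLinearMap.adjoint_inner_right, opTens_tens, opTens_tens, inner_tens, inner_tens,
      ContinuousLinearMap.adjoint_inner_right, ContinuousLinearMap.adjoint_inner_right]

theorem SWord_e (ω α : Word n) : SWord ω (e α) = e (ω * α) := by
  induction ω using FreeMonoid.inductionOn' generalizing α with
  | one => simp [SWord]
  | of_mul i ω ih =>
    have : SWord (FreeMonoid.of i * ω) = S n i * SWord ω := by simp [SWord]
    rw [this, mul_apply_eq_comp, ih, S_e, mul_assoc]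

theorem SWord_mem_discAlgebra (ω : Word n) : SWord ω ∈ discAlgebra n := by
  refine Subalgebra.le_topologicalClosure _ ?_
  induction ω using FreeMonoid.inductionOn' with
  | one => simp [SWord]
  | of_mul i ω ih =>
    have : SWord (FreeMonoid.of i * ω) = S n i * SWord ω := by simp [SWord]
    rw [this]
    exact Subalgebra.mul_mem _ (Algebra.subset_adjoin ⟨i, rfl⟩) ih

theorem inner_e_adjoint_SWord_e (ω α β : Word n) :
    inner ℂ (e β) (ContinuousLinearMap.adjoint (SWord ω) (e α)) =
      if α = ω * β then (1 : ℂ) else 0 := by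
  rw [ContinuousLinearMap.adjoint_inner_right, SWord_e, inner_e]
  simp only [eq_comm]

theorem inner_opTens_SWord (X : E →L[ℂ] E) (ω α β : Word n) (x y : E) :
    inner ℂ (tens y (e β)) (opTens X (SWord ω) (tens x (e α))) =
      if β = ω * α then inner ℂ y (X x) else 0 := by
  rw [opTens_tens, SWord_e, inner_tens_e]

theorem inner_opTens_adjoint_SWord (X : E →L[ℂ] E) (ω α β : Word n) (x y : E) :
    inner ℂ (tens y (e β)) (opTens X (ContinuousLinearMap.adjoint (SWord ω)) (tens x (e α))) =
      if α = ω * β then inner ℂ y (X x) else 0 := by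
  rw [opTens_tens, inner_tens, inner_e_adjoint_SWord_e, mul_ite, mul_one, mul_zero]

end Basics

/-! ### Word kernels and the matrix of a multi-Toeplitz operator -/

section Kernels

variable {n : ℕ}

open Classical in
/-- The kernel on words with value `f ω` at `(ω α, α)` for `ω ≠ 1`, and zero elsewhere. -/
def strictKernel {M : Type*} [Zero M] (f : Word n → M) (β α : Word n) : M :=
  if h : ∃ ω : Word n, ω ≠ 1 ∧ β = ω * α then f h.choose else 0

/-- Right cancellation makes the prefix unique, so the word picked by choice is ω. -/
theorem strictKernel_mul {M : Type*} [Zero M] (f : Word n → M) {ω : Word n} (hω : ω ≠ 1)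
    (α : Word n) : strictKernel f (ω * α) α = f ω := by
  have h : ∃ ω' : Word n, ω' ≠ 1 ∧ ω * α = ω' * α := ⟨ω, hω, rfl⟩
  rw [strictKernel, dif_pos h, mul_right_cancel h.choose_spec.2.symm]

theorem strictKernel_eq_zero {M : Type*} [Zero M] (f : Word n → M) {β α : Word n}
    (h : ∀ ω : Word n, ω ≠ 1 → β ≠ ω * α) : strictKernel f β α = 0 := by
  rw [strictKernel, dif_neg]
  rintro ⟨ω, h1, h2⟩
  exact h ω h1 h2

theorem strictKernel_of_length_le {M : Type*} [Zero M] (f : Word n → M) {β α : Word n}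
    (h : β.length ≤ α.length) : strictKernel f β α = 0 := by
  refine strictKernel_eq_zero f fun ω hω => ?_
  rintro rfl
  rw [FreeMonoid.length_mul] at h
  exact hω (FreeMonoid.length_eq_zero.1 (by omega))

theorem hasSum_strictKernel_graded (g : Word n → ℂ) (β α : Word n) :
    HasSum (fun k : ℕ => ∑ ω ∈ wordsOfLength n (k + 1), if β = ω * α then g ω else 0)
      (strictKernel g β α) := by
  by_cases h : ∃ ω : Word n, ω ≠ 1 ∧ β = ω * α
  · obtain ⟨ω, hω, rfl⟩ := h
    rw [strictKernel_mul g hω]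
    have hpos : ω.length ≠ 0 := fun h => hω (FreeMonoid.length_eq_zero.1 h)
    -- Since ω is not the empty word, the subtraction is exact: only the degree k + 1 = |ω|
    -- contributes.
    have hk : ∀ k : ℕ, (∑ ω' ∈ wordsOfLength n (k + 1), if ω * α = ω' * α then g ω' else 0) =
        if k = ω.length - 1 then g ω else 0 := by
      intro k
      simp only [mul_left_inj, Finset.sum_ite_eq, mem_wordsOfLength]
      congr 1
      exact propext (by omega)
    simp only [hk]
    exact hasSum_ite_eq _ _
  · push Not at h
    rw [strictKernel_eq_zero g h]
    convert! (hasSum_zero : HasSum (fun _ : ℕ => (0 : ℂ)) 0) using 2 with k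
    refine Finset.sum_eq_zero fun ω hω => if_neg (h ω ?_)
    rintro rfl
    simp [mem_wordsOfLength] at hω

theorem hasSum_strictKernel (g : Word n → ℂ) (β α : Word n) :
    HasSum (fun ω : {ω : Word n // ω ≠ 1} => if β = ω.1 * α then g ω.1 else 0)
      (strictKernel g β α) := by
  by_cases h : ∃ ω : Word n, ω ≠ 1 ∧ β = ω * α
  · obtain ⟨ω, hω, rfl⟩ := h
    rw [strictKernel_mul g hω]
    have hk : ∀ ω' : {ω : Word n // ω ≠ 1}, (if ω * α = ω'.1 * α then g ω'.1 else 0) =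
        if ω' = ⟨ω, hω⟩ then g ω else 0 := by
      intro ω'
      simp only [mul_left_inj, Subtype.ext_iff]
      by_cases hc : ω = ω'.1
      · rw [if_pos hc, if_pos hc.symm, hc]
      · rw [if_neg hc, if_neg (Ne.symm hc)]
    simp only [hk]
    exact hasSum_ite_eq _ _
  · push Not at h
    rw [strictKernel_eq_zero g h]
    convert! (hasSum_zero : HasSum (fun _ : {ω : Word n // ω ≠ 1} => (0 : ℂ)) 0) using 2 with ω
    exact if_neg (h ω.1 ω.2)

/-- The distance of the lengths of two words. -/
def lengthDist (β α : Word n) : ℕ := (β.length - α.length) + (α.length - β.length)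

theorem lengthDist_comm (β α : Word n) : lengthDist β α = lengthDist α β := add_comm _ _

theorem lengthDist_self (α : Word n) : lengthDist α α = 0 := by simp [lengthDist]

theorem lengthDist_mul (ω α : Word n) : lengthDist (ω * α) α = ω.length := by
  simp [lengthDist, FreeMonoid.length_mul]

variable {E : Type*} [NormedAddCommGroup E] [InnerProductSpace ℂ E]

/-- On the support β = ωα the power |ω| is the length distance of β and α, so damping the
coefficients amounts to multiplying each entry by a scalar that depends only on the two lengths. -/
theorem strictKernel_inner (A : Word n → E →L[ℂ] E) (c : ℂ) (x y : E) (β α : Word n) :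
    strictKernel (fun ω => c ^ ω.length * inner ℂ y (A ω x)) β α =
      c ^ lengthDist β α * inner ℂ y (strictKernel A β α x) := by
  by_cases h : ∃ ω : Word n, ω ≠ 1 ∧ β = ω * α
  · obtain ⟨ω, hω, rfl⟩ := h
    rw [strictKernel_mul _ hω, strictKernel_mul _ hω, lengthDist_mul]
  · push Not at h
    rw [strictKernel_eq_zero _ h, strictKernel_eq_zero _ h]
    simp

/-- The matrix of the formal series with coefficients `A`, `B` in the basis of words. -/
def symbolKernel (A B : Word n → E →L[ℂ] E) (β α : Word n) : E →L[ℂ] E :=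
  -- The arguments of the B part are exchanged because S_ω* sends e_{ωβ} to e_β.
  strictKernel B α β + (if β = α then A 1 else 0) + strictKernel A β α

theorem symbolKernel_mul_left (A B : Word n → E →L[ℂ] E) (ω α : Word n) :
    symbolKernel A B (ω * α) α = A ω := by
  rw [symbolKernel, strictKernel_of_length_le B (by simp [FreeMonoid.length_mul]), zero_add]
  by_cases hω : ω = 1
  · subst hω
    rw [one_mul, if_pos rfl, strictKernel_of_length_le A le_rfl, add_zero]
  · rw [strictKernel_mul A hω, if_neg (by simpa using hω), zero_add]

theorem symbolKernel_mul_right (A B : Word n → E →L[ℂ] E) {ω : Word n} (hω : ω ≠ 1) (β : Word n) :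
    symbolKernel A B β (ω * β) = B ω := by
  rw [symbolKernel, strictKernel_of_length_le A (by simp [FreeMonoid.length_mul]), add_zero,
    strictKernel_mul B hω, if_neg (by simpa using hω), add_zero]

theorem symbolKernel_eq_zero (A B : Word n → E →L[ℂ] E) {β α : Word n}
    (h1 : ∀ ω, β ≠ ω * α) (h2 : ∀ ω, α ≠ ω * β) : symbolKernel A B β α = 0 := by
  rw [symbolKernel, strictKernel_eq_zero _ fun ω _ => h1 ω, strictKernel_eq_zero _ fun ω _ => h2 ω,
    if_neg (by simpa using h1 1)]
  simp

theorem mul_of_eq_mul_of_iff {α β : Word n} {i j : Fin n} :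
    α * FreeMonoid.of i = β * FreeMonoid.of j ↔ α = β ∧ i = j := by
  constructor
  · intro h
    have h' : α.toList ++ [i] = β.toList ++ [j] := congrArg FreeMonoid.toList h
    obtain ⟨h1, h2⟩ := List.append_inj' h' rfl
    exact ⟨FreeMonoid.toList.injective h1, by simpa using h2⟩
  · rintro ⟨rfl, rfl⟩
    rfl

theorem eq_one_or_eq_mul_of (α : Word n) : α = 1 ∨ ∃ (β : Word n) (i : Fin n),
    α = β * FreeMonoid.of i := by
  rcases List.eq_nil_or_concat α.toList with h | ⟨l, i, h⟩
  · exact Or.inl (FreeMonoid.toList.injective h)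
  · exact Or.inr ⟨FreeMonoid.ofList l, i, FreeMonoid.toList.injective (by simpa using h)⟩

/-- Two words are comparable for the suffix order, or they differ at some letter followed by a
common suffix. -/
theorem word_trichotomy (β α : Word n) : (∃ ω, β = ω * α) ∨ (∃ ω, ω ≠ 1 ∧ α = ω * β) ∨
    ∃ (β' α' γ : Word n) (i j : Fin n), i ≠ j ∧ β = β' * FreeMonoid.of i * γ ∧
      α = α' * FreeMonoid.of j * γ := by
  induction hk : α.length generalizing α β with
  | zero =>
    rw [FreeMonoid.length_eq_zero] at hk
    exact Or.inl ⟨β, by simp [hk]⟩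
  | succ k ih =>
    rcases eq_one_or_eq_mul_of α with rfl | ⟨α', j, rfl⟩
    · simp at hk
    rcases eq_one_or_eq_mul_of β with rfl | ⟨β', i, rfl⟩
    · exact Or.inr (Or.inl ⟨α' * FreeMonoid.of j, by
        intro h; rw [h] at hk; simp at hk, by simp⟩)
    by_cases hij : i = j
    · subst hij
      rcases ih β' α' (by simpa [FreeMonoid.length_mul] using hk) with
        ⟨ω, rfl⟩ | ⟨ω, hω, rfl⟩ | ⟨b, a, γ, i', j', h, rfl, rfl⟩
      · exact Or.inl ⟨ω, mul_assoc _ _ _⟩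
      · exact Or.inr (Or.inl ⟨ω, hω, mul_assoc _ _ _⟩)
      · exact Or.inr (Or.inr ⟨b, a, γ * FreeMonoid.of i, i', j', h, by simp [mul_assoc],
          by simp [mul_assoc]⟩)
    · exact Or.inr (Or.inr ⟨β', α', 1, i, j, hij, by simp, by simp⟩)

/-- This is the multi-Toeplitz identity at the level of kernels: a relation β gᵢ = ω α gⱼ forces i =
j and β = ωα, and likewise with the roles exchanged. -/
theorem symbolKernel_mul_of (A B : Word n → E →L[ℂ] E) (β α : Word n) (i j : Fin n) :
    symbolKernel A B (β * FreeMonoid.of i) (α * FreeMonoid.of j) =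
      if i = j then symbolKernel A B β α else 0 := by
  have key : ∀ {α β ω : Word n} {i j : Fin n},
      β * FreeMonoid.of i = ω * (α * FreeMonoid.of j) ↔ β = ω * α ∧ i = j := by
    intro α β ω i j
    rw [← mul_assoc, mul_of_eq_mul_of_iff]
  split_ifs with hij
  · subst hij
    by_cases h1 : ∃ ω, β = ω * α
    · obtain ⟨ω, rfl⟩ := h1
      rw [mul_assoc, symbolKernel_mul_left, symbolKernel_mul_left]
    by_cases h2 : ∃ ω, α = ω * β
    · obtain ⟨ω, rfl⟩ := h2
      have hω : ω ≠ 1 := by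
        rintro rfl
        exact h1 ⟨1, by simp⟩
      rw [mul_assoc, symbolKernel_mul_right _ _ hω, symbolKernel_mul_right _ _ hω]
    push Not at h1 h2
    rw [symbolKernel_eq_zero A B h1 h2, symbolKernel_eq_zero]
    · exact fun ω h => h1 ω (key.1 h).1
    · exact fun ω h => h2 ω (key.1 h).1
  · rw [symbolKernel_eq_zero]
    · exact fun ω h => hij (key.1 h).2
    · exact fun ω h => hij (key.1 h).2.symm

variable {A B : Word n → E →L[ℂ] E} {T : HTensor E n →L[ℂ] HTensor E n}

theorem inner_opTens_R_conj [CompleteSpace E] (T : HTensor E n →L[ℂ] HTensor E n) (i j : Fin n)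
    (x y : E) (α β : Word n) :
    inner ℂ (tens y (e β)) ((opTens (.id ℂ E) (ContinuousLinearMap.adjoint (R n i)) ∘L T ∘L
      opTens (.id ℂ E) (R n j)) (tens x (e α))) =
      inner ℂ (tens y (e (β * FreeMonoid.of i))) (T (tens x (e (α * FreeMonoid.of j)))) := by
  have h : opTens (.id ℂ E) (ContinuousLinearMap.adjoint (R n i)) =
      ContinuousLinearMap.adjoint (opTens (.id ℂ E) (R n i)) := by
    rw [adjoint_opTens, ContinuousLinearMap.adjoint_id]
  rw [h, ContinuousLinearMap.comp_apply, ContinuousLinearMap.comp_apply,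
    ContinuousLinearMap.adjoint_inner_right, opTens_tens, opTens_tens, R_e, R_e]
  rfl

/-- The entries of a multi-Toeplitz operator in the basis of words are given by the kernel of its
Fourier representation. -/
theorem inner_eq_symbolKernel [CompleteSpace E] (hT : IsMultiToeplitz T)
    (hF : IsFourierRepr A B T) (x y : E) (α β : Word n) :
    inner ℂ (tens y (e β)) (T (tens x (e α))) = inner ℂ y (symbolKernel A B β α x) := by
  have step : ∀ (β α : Word n) (i j : Fin n),
      inner ℂ (tens y (e (β * FreeMonoid.of i))) (T (tens x (e (α * FreeMonoid.of j)))) =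
        if i = j then inner ℂ (tens y (e β)) (T (tens x (e α))) else 0 := by
    intro β α i j
    rw [← inner_opTens_R_conj, hT i j]
    split_ifs <;> simp
  -- Iterating the Toeplitz relation letter by letter removes a whole common suffix γ.
  have shift : ∀ (γ β α : Word n), inner ℂ (tens y (e (β * γ))) (T (tens x (e (α * γ)))) =
      inner ℂ (tens y (e β)) (T (tens x (e α))) := by
    intro γ
    induction γ using FreeMonoid.inductionOn' with
    | one => simp
    | of_mul i γ ih =>
      intro β α
      rw [← mul_assoc, ← mul_assoc, ih, step, if_pos rfl]
  rcases word_trichotomy β α with ⟨ω, rfl⟩ | ⟨ω, hω, rfl⟩ | ⟨β', α', γ, i, j, hij, rfl, rfl⟩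
  · rw [symbolKernel_mul_left, hF.1]
    simpa using shift α ω 1
  · rw [symbolKernel_mul_right _ _ hω, hF.2 ω hω]
    simpa using shift β 1 ω
  · rw [shift, step, if_neg hij]
    have h0 : symbolKernel A B (β' * FreeMonoid.of i * γ) (α' * FreeMonoid.of j * γ) = 0 := by
      rw [symbolKernel_eq_zero]
      · intro ω h
        rw [← mul_assoc, mul_left_inj, ← mul_assoc, mul_of_eq_mul_of_iff] at h
        exact hij h.2
      · intro ω h
        rw [← mul_assoc, mul_left_inj, ← mul_assoc, mul_of_eq_mul_of_iff] at h
        exact hij h.2.symm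
    simp [h0]

theorem isMultiToeplitz_of_inner [CompleteSpace E]
    (h : ∀ (x y : E) (α β : Word n),
      inner ℂ (tens y (e β)) (T (tens x (e α))) = inner ℂ y (symbolKernel A B β α x)) :
    IsMultiToeplitz T := by
  intro i j
  refine ext_entries fun x y α β => ?_
  rw [inner_opTens_R_conj, h, symbolKernel_mul_of]
  split_ifs
  · rw [h]
  · simp

theorem isFourierRepr_of_inner
    (h : ∀ (x y : E) (α β : Word n),
      inner ℂ (tens y (e β)) (T (tens x (e α))) = inner ℂ y (symbolKernel A B β α x)) :
    IsFourierRepr A B T := by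
  refine ⟨fun α x y => ?_, fun α hα x y => ?_⟩
  · rw [h]
    have := symbolKernel_mul_left A B α 1
    rw [mul_one] at this
    rw [this]
  · rw [h]
    have := symbolKernel_mul_right A B hα 1
    rw [mul_one] at this
    rw [this]

end Kernels

/-! ### Square summable columns of coefficients -/

section ColumnBounded

variable {E : Type*} [NormedAddCommGroup E] [InnerProductSpace ℂ E] {n : ℕ}

/-- `∑_α A_α^* A_α` is bounded. -/
def ColumnBounded (A : Word n → E →L[ℂ] E) (C : ℝ) : Prop :=
  ∀ (x : E) (s : Finset (Word n)), ∑ α ∈ s, ‖A α x‖ ^ 2 ≤ C * ‖x‖ ^ 2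

theorem ColumnBounded.summable {A : Word n → E →L[ℂ] E} {C : ℝ} (h : ColumnBounded A C) (x : E) :
    Summable fun α => ‖A α x‖ ^ 2 :=
  summable_of_sum_le (fun _ => by positivity) (h x)

theorem inner_wot_sum {ι : Type*} (s : Finset ι) (f : ι → E →WOT[ℂ] E) (x y : E) :
    inner ℂ y ((∑ i ∈ s, f i) x) = ∑ i ∈ s, inner ℂ y (f i x) :=
  map_sum (AddMonoidHom.mk' (fun P : E →WOT[ℂ] E => inner ℂ y (P x))
    fun P Q => inner_add_right y (P x) (Q x)) f s

end ColumnBounded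

/-! ### Coordinates in the word basis and condition (i) -/

section Coordinates

variable {E : Type*} [NormedAddCommGroup E] [InnerProductSpace ℂ E] [CompleteSpace E] {n : ℕ}

theorem isHilbertSum_embed :
    IsHilbertSum ℂ (fun _ : Word n => E) (fun α => (embed α : E →ₗᵢ[ℂ] HTensor E n)) := by
  refine IsHilbertSum.mk orthogonalFamily_embed ?_
  rw [← (Submodule.dense_iff_topologicalClosure_eq_top.1 dense_polynomials)]
  refine Submodule.topologicalClosure_mono (Submodule.span_le.2 ?_)
  rintro _ ⟨x, α, rfl⟩
  exact Submodule.mem_iSup_of_mem α ⟨x, rfl⟩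

/-- The coordinate `c_α` of a vector `∑ c_α ⊗ e_α`. -/
def coord (α : Word n) : HTensor E n →L[ℂ] E :=
  ContinuousLinearMap.adjoint (embed α).toContinuousLinearMap

theorem inner_coord (α : Word n) (x : E) (v : HTensor E n) :
    inner ℂ x (coord α v) = inner ℂ (tens x (e α)) v :=
  ContinuousLinearMap.adjoint_inner_right _ _ _

theorem inner_coord_left (α : Word n) (x : E) (v : HTensor E n) :
    inner ℂ (coord α v) x = inner ℂ v (tens x (e α)) :=
  ContinuousLinearMap.adjoint_inner_left _ _ _

theorem hasSum_coord (v : HTensor E n) : HasSum (fun α => tens (coord α v) (e α)) v := by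
  set w := (isHilbertSum_embed (E := E) (n := n)).linearIsometryEquiv v with hw
  have h : HasSum (fun α => tens (w α) (e α)) v := by
    have := (isHilbertSum_embed (E := E) (n := n)).hasSum_linearIsometryEquiv_symm w
    rwa [hw, LinearIsometryEquiv.symm_apply_apply] at this
  have hc : ∀ α, coord α v = w α := by
    intro α
    refine ext_inner_left ℂ fun x => ?_
    rw [inner_coord]
    have h1 := h.mapL (innerSL ℂ (tens x (e α)))
    refine h1.unique ?_
    convert! hasSum_ite_eq α (inner ℂ x (w α)) using 2 with β
    simp only [innerSL_apply_apply, inner_tens_e, eq_comm]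
    split_ifs with hβ
    · rw [hβ]
    · rfl
  simpa only [hc] using h

theorem hasSum_inner_coord (u v : HTensor E n) :
    HasSum (fun α => inner ℂ (coord α u) (coord α v)) (inner ℂ u v) := by
  have := (hasSum_coord v).mapL (innerSL ℂ u)
  simpa only [innerSL_apply_apply, inner_coord_left] using this

theorem hasSum_norm_sq_coord (v : HTensor E n) :
    HasSum (fun α => ‖coord α v‖ ^ 2) (‖v‖ ^ 2) := by
  have := Complex.hasSum_re (hasSum_inner_coord v v)
  simpa [inner_self_eq_norm_sq_to_K, ← Complex.ofReal_pow] using this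

/-- The operators `A_α` are the nontrivial coordinates of one bounded operator
`x ↦ ∑ A_α x ⊗ e_α`. -/
theorem summable_wot_of_inner {A : Word n → E →L[ℂ] E} {V : E →L[ℂ] HTensor E n}
    (h : ∀ α : Word n, α ≠ 1 → ∀ x y : E, inner ℂ (tens y (e α)) (V x) = inner ℂ y (A α x)) :
    Summable (fun α : {α : Word n // α ≠ 1} =>
      ContinuousLinearMapWOT.ofCLM (ContinuousLinearMap.adjoint (A α) ∘L A α)) := by
  have hA : ∀ α : Word n, α ≠ 1 → A α = coord α ∘L V := by
    intro α hα
    refine ContinuousLinearMap.ext fun x => ext_inner_left ℂ fun y => ?_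
    rw [← h α hα, ContinuousLinearMap.comp_apply, inner_coord]
  have hs : Summable (fun α : Word n => ContinuousLinearMapWOT.ofCLM
      (ContinuousLinearMap.adjoint (coord α ∘L V) ∘L (coord α ∘L V))) := by
    -- By Parseval, the sum of ⟨c_α(V y), c_α(V x)⟩ over all α is ⟨V y, V x⟩, so the weak sum is V*
    -- V.
    refine ⟨ContinuousLinearMapWOT.ofCLM (ContinuousLinearMap.adjoint V ∘L V), ?_⟩
    refine ContinuousLinearMapWOT.tendsto_iff_forall_inner_apply_tendsto.2 fun x y => ?_
    have h1 := hasSum_inner_coord (V y) (V x)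
    rw [HasSum, ← ContinuousLinearMap.adjoint_inner_right] at h1
    refine h1.congr fun s => ?_
    rw [inner_wot_sum]
    refine Finset.sum_congr rfl fun α _ => ?_
    rw [ContinuousLinearMapWOT.ofCLM_apply, ContinuousLinearMap.comp_apply,
      ContinuousLinearMap.adjoint_inner_right]
    rfl
  have := (Finset.summable_compl_iff ({1} : Finset (Word n))).2 hs
  have h2 := (Equiv.subtypeEquivRight (p := fun α : Word n => α ≠ 1)
    (q := fun α => α ∉ ({1} : Finset (Word n))) (by simp)).summable_iff.2 this
  refine h2.congr fun α => ?_
  rw [hA α.1 α.2]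
  rfl

/-- The diagonal terms ‖A_α x‖² are nonnegative, so every finite sum of them is at most ⟨x, P x⟩ for
the weak sum P. -/
theorem exists_columnBounded {A : Word n → E →L[ℂ] E}
    (h : Summable (fun α : {α : Word n // α ≠ 1} =>
      ContinuousLinearMapWOT.ofCLM (ContinuousLinearMap.adjoint (A α) ∘L A α))) :
    ∃ C, 0 ≤ C ∧ ColumnBounded A C := by
  obtain ⟨P, hP⟩ := h
  -- The first summand pays for the empty word, which the weak sum omits.
  refine ⟨‖A 1‖ ^ 2 + ‖P.toCLM‖, by positivity, fun x s => ?_⟩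
  have h1 := ContinuousLinearMapWOT.tendsto_iff_forall_inner_apply_tendsto.1 hP x x
  have h2 : HasSum (fun α : {α : Word n // α ≠ 1} => ‖A α x‖ ^ 2)
      (inner ℂ x (P.toCLM x)).re := by
    have h3 := (Complex.continuous_re.tendsto _).comp h1
    refine h3.congr fun s => ?_
    rw [Function.comp_apply, inner_wot_sum, Complex.re_sum]
    refine Finset.sum_congr rfl fun α _ => ?_
    rw [ContinuousLinearMapWOT.ofCLM_apply, ContinuousLinearMap.comp_apply,
      ContinuousLinearMap.adjoint_inner_right, inner_self_eq_norm_sq_to_K]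
    simp [← Complex.ofReal_pow]
  have h3 : ∑ α ∈ s.subtype (fun α => α ≠ 1), ‖A α x‖ ^ 2 ≤ ‖P.toCLM‖ * ‖x‖ ^ 2 := by
    refine (sum_le_hasSum _ (fun _ _ => by positivity) h2).trans ?_
    refine (Complex.re_le_norm _).trans ((norm_inner_le_norm _ _).trans ?_)
    have := P.toCLM.le_opNorm x
    nlinarith [norm_nonneg x]
  have h4 : ‖A 1 x‖ ^ 2 ≤ ‖A 1‖ ^ 2 * ‖x‖ ^ 2 := by
    rw [← mul_pow]
    exact pow_le_pow_left₀ (norm_nonneg _) ((A 1).le_opNorm x) 2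
  have h5 : ∑ α ∈ s, ‖A α x‖ ^ 2 ≤ ‖A 1 x‖ ^ 2 + ∑ α ∈ s.filter (fun α => α ≠ 1), ‖A α x‖ ^ 2 := by
    rw [← Finset.sum_filter_add_sum_filter_not s (fun α => α = 1)]
    refine add_le_add_left ?_ _
    refine (Finset.sum_le_sum_of_subset_of_nonneg (t := {1}) ?_ (fun _ _ _ => by positivity)).trans
      (by simp)
    intro α hα
    simpa using (Finset.mem_filter.1 hα).2
  rw [Finset.sum_subtype_eq_sum_filter (f := fun α => ‖A α x‖ ^ 2)] at h3
  linarith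

end Coordinates

/-! ### Norm estimates for homogeneous parts -/

section Homogeneous

variable {E : Type*} [NormedAddCommGroup E] [InnerProductSpace ℂ E] {n : ℕ}

theorem posPart_apply_tens (A : Word n → E →L[ℂ] E) (r : ℝ) (k : ℕ) (x : E) (β : Word n) :
    posPart A r k (tens x (e β)) =
      ∑ α ∈ wordsOfLength n k, tens ((r : ℂ) ^ k • A α x) (e (α * β)) := by
  rw [posPart, sum_apply]
  refine Finset.sum_congr rfl fun α hα => ?_
  rw [opTens_smul, smul_apply, opTens_tens, SWord_e, tens_smul_left, mem_wordsOfLength.1 hα]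

/-- For words ω of fixed length k, the product ωβ determines both ω and β. The vectors A_ω h_β ⊗
e_{ωβ} are therefore mutually orthogonal, and the column bound applies to each h_β separately. -/
theorem norm_posPart_le {A : Word n → E →L[ℂ] E} {C : ℝ} (hC : 0 ≤ C) (hA : ColumnBounded A C)
    (r : ℝ) (k : ℕ) :
    ‖(posPart A r k : HTensor E n →L[ℂ] HTensor E n)‖ ≤ √C * |r| ^ k := by
  refine ContinuousLinearMap.opNorm_le_bound _ (by positivity) fun h => ?_
  refine dense_polynomials.induction (P := fun h => ‖posPart A r k h‖ ≤ √C * |r| ^ k * ‖h‖) ?_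
    (isClosed_le (by fun_prop) (by fun_prop)) h
  intro q hq
  obtain ⟨s, h, rfl⟩ := exists_eq_sum_of_mem_polynomials hq
  refine abs_le_of_sq_le_sq' ?_ (by positivity) |>.2
  rw [mul_pow, mul_pow, Real.sq_sqrt hC, norm_sq_polynomial, map_sum]
  simp only [posPart_apply_tens]
  rw [Finset.sum_comm, ← Finset.sum_product',
    norm_sq_sum_tens _ (fun p : Word n × Word n => p.1 * p.2), Finset.sum_product_right,
    Finset.mul_sum]
  · refine Finset.sum_le_sum fun β _ => ?_
    have := hA (h β) (wordsOfLength n k)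
    simp only [norm_smul, norm_pow, Complex.norm_real, Real.norm_eq_abs, mul_pow,
      ← Finset.mul_sum]
    calc _ ≤ (|r| ^ k) ^ 2 * (C * ‖h β‖ ^ 2) := by gcongr
      _ = _ := by ring
  -- Injectivity: cut both products after their first k letters.
  · rintro ⟨a, b⟩ hab ⟨c, d⟩ hcd h
    simp only [Finset.coe_product, Set.mem_prod, Finset.mem_coe, mem_wordsOfLength] at hab hcd
    have := List.append_inj (congrArg FreeMonoid.toList h)
      (hab.1.trans hcd.1.symm : a.toList.length = c.toList.length)
    exact Prod.ext (FreeMonoid.toList.injective this.1) (FreeMonoid.toList.injective this.2)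

theorem summable_clm_of_norm_le {X : Type*} [NormedAddCommGroup X] [NormedSpace ℂ X]
    [CompleteSpace X] {f : ℕ → X →L[ℂ] X} {g : ℕ → ℝ} (hg : Summable g) (h : ∀ k, ‖f k‖ ≤ g k) :
    Summable f :=
  Summable.of_norm_bounded hg h

theorem summable_posPart {A : Word n → E →L[ℂ] E} {C : ℝ} (hC : 0 ≤ C) (hA : ColumnBounded A C)
    {r : ℝ} (hr : r ∈ Set.Ico (0 : ℝ) 1) :
    Summable (fun k : ℕ => (posPart A r (k + 1) : HTensor E n →L[ℂ] HTensor E n)) := by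
  have hr' : |r| < 1 := by
    rw [abs_of_nonneg hr.1]
    exact hr.2
  have hg : Summable fun k : ℕ => √C * |r| ^ (k + 1) :=
    ((summable_nat_add_iff 1).2 (summable_geometric_of_lt_one (abs_nonneg r) hr')).mul_left _
  have h1 : ∀ k : ℕ, ‖(posPart A r (k + 1) : HTensor E n →L[ℂ] HTensor E n)‖ ≤
      √C * |r| ^ (k + 1) := fun k => norm_posPart_le hC hA r (k + 1)
  exact summable_clm_of_norm_le hg h1

/-- Transfers norm summability and membership in 𝒜ₙ(ℰ)* from the analytic parts to the coanalytic
ones. -/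
theorem adjoint_posPart [CompleteSpace E] (B : Word n → E →L[ℂ] E) (r : ℝ) (k : ℕ) :
    ContinuousLinearMap.adjoint (posPart (fun α => ContinuousLinearMap.adjoint (B α)) r k) =
      (negPart B r k : HTensor E n →L[ℂ] HTensor E n) := by
  rw [posPart, negPart, map_sum]
  refine Finset.sum_congr rfl fun α _ => ?_
  rw [opTens_smul, opTens_smul, map_smulₛₗ, adjoint_opTens, ContinuousLinearMap.adjoint_adjoint]
  simp

theorem posPart_mem_discOpSpace (A : Word n → E →L[ℂ] E) (r : ℝ) (k : ℕ) :
    posPart A r k ∈ discOpSpace E n :=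
  Submodule.sum_mem _ fun α _ => Submodule.le_topologicalClosure _ <|
    Submodule.subset_span ⟨_, _, Subalgebra.smul_mem _ (SWord_mem_discAlgebra α) _, rfl⟩

end Homogeneous

/-! ### The kernel r^|j - k| as a contractive Schur multiplier -/

section SchurMultiplier

variable {E : Type*} [NormedAddCommGroup E] [InnerProductSpace ℂ E] {n : ℕ}

/-- The coordinates of a sequence of unit vectors `v_j` of `ℓ²` with
`⟨v_j, v_k⟩ = r ^ |j - k|`. -/
def poissonVector (r : ℝ) (j m : ℕ) : ℝ :=
  if m = 0 then r ^ j else if m ≤ j then √(1 - r ^ 2) * r ^ (j - m) else 0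

theorem sum_poissonVector_zero (r : ℝ) (k N : ℕ) :
    ∑ m ∈ Finset.range (N + 1), poissonVector r 0 m * poissonVector r k m = r ^ k := by
  rw [Finset.sum_range_succ', Finset.sum_eq_zero] <;> simp [poissonVector]

/-- Passing from (j, k) to (j + 1, k + 1) changes only the start of the sum: coordinate 0 gives r² ·
r^(j + k), the new coordinate 1 gives (1 - r²) · r^(j + k), and together they restore the old term
r^(j + k). All other coordinates are shifted by one. -/
theorem sum_poissonVector {r : ℝ} (hr : r ^ 2 ≤ 1) {j k N : ℕ} (hj : j < N) (hk : k < N) :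
    ∑ m ∈ Finset.range N, poissonVector r j m * poissonVector r k m =
      r ^ ((j - k) + (k - j)) := by
  obtain ⟨N, rfl⟩ : ∃ M, N = M + 1 := ⟨N - 1, by omega⟩
  induction N generalizing j k with
  | zero =>
    obtain rfl : j = 0 := by omega
    rw [sum_poissonVector_zero]
    simp
  | succ N ih =>
    rcases j with _ | j
    · rw [sum_poissonVector_zero]
      simp
    rcases k with _ | k
    · simp only [mul_comm (poissonVector r (j + 1) _)]
      rw [sum_poissonVector_zero]
      simp
    have h := ih (j := j) (k := k) (by omega) (by omega)
    have h0 : ∀ i : ℕ, poissonVector r i 0 = r ^ i := fun i => by simp [poissonVector]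
    have h1 : ∀ i : ℕ, poissonVector r (i + 1) 1 = √(1 - r ^ 2) * r ^ i := fun i => by
      simp [poissonVector]
    have h2 : ∀ i m : ℕ, poissonVector r (i + 1) (m + 1 + 1) = poissonVector r i (m + 1) :=
      fun i m => by simp [poissonVector]
    have hs := Real.mul_self_sqrt (sub_nonneg.2 hr)
    rw [Nat.add_sub_add_right, Nat.add_sub_add_right, ← h, Finset.sum_range_succ',
      Finset.sum_range_succ', Finset.sum_range_succ' _ N]
    simp only [zero_add, h0, h1, h2]
    rw [add_assoc]
    congr 1
    linear_combination (r ^ j * r ^ k) * hs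

/-- Schur multiplication by a finite sum of products of weights does not increase the norm. -/
theorem norm_schur_le (T : HTensor E n →L[ℂ] HTensor E n) (s t : Finset (Word n))
    (h k : Word n → E) (N : ℕ) (w : ℕ → Word n → ℝ)
    (hs : ∀ α ∈ s, ∑ m ∈ Finset.range N, w m α ^ 2 ≤ 1)
    (ht : ∀ α ∈ t, ∑ m ∈ Finset.range N, w m α ^ 2 ≤ 1) :
    ‖∑ β ∈ t, ∑ α ∈ s, ((∑ m ∈ Finset.range N, w m β * w m α : ℝ) : ℂ) *
      inner ℂ (tens (k β) (e β)) (T (tens (h α) (e α)))‖ ≤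
      ‖T‖ * ‖∑ α ∈ s, tens (h α) (e α)‖ * ‖∑ β ∈ t, tens (k β) (e β)‖ := by
  -- `D m` applies the diagonal operator with weights `w m`. The Schur product becomes the sum of
  -- ⟨D_m k, T D_m h⟩, and Cauchy–Schwarz in m finishes since the squared weights of each word sum
  -- to at most 1.
  set D : ℕ → Finset (Word n) → (Word n → E) → HTensor E n :=
    fun m s h => ∑ α ∈ s, tens ((w m α : ℂ) • h α) (e α) with hD
  have hnorm : ∀ (s : Finset (Word n)) (h : Word n → E),
      (∀ α ∈ s, ∑ m ∈ Finset.range N, w m α ^ 2 ≤ 1) →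
      √(∑ m ∈ Finset.range N, ‖D m s h‖ ^ 2) ≤ ‖∑ α ∈ s, tens (h α) (e α)‖ := by
    intro s h hs
    refine Real.sqrt_le_iff.2 ⟨norm_nonneg _, ?_⟩
    rw [norm_sq_polynomial]
    simp only [hD, norm_sq_polynomial, norm_smul, Complex.norm_real, mul_pow, Real.norm_eq_abs,
      sq_abs]
    rw [Finset.sum_comm]
    refine Finset.sum_le_sum fun α hα => ?_
    rw [← Finset.sum_mul]
    exact mul_le_of_le_one_left (by positivity) (hs α hα)
  have hsum : ∑ β ∈ t, ∑ α ∈ s, ((∑ m ∈ Finset.range N, w m β * w m α : ℝ) : ℂ) *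
      inner ℂ (tens (k β) (e β)) (T (tens (h α) (e α))) =
      ∑ m ∈ Finset.range N, inner ℂ (D m t k) (T (D m s h)) := by
    simp only [hD, map_sum, sum_inner, inner_sum, tens_smul_left, map_smul, inner_smul_left,
      inner_smul_right, Complex.conj_ofReal, Complex.ofReal_sum, Complex.ofReal_mul,
      Finset.sum_mul]
    simp only [Finset.mul_sum]
    rw [Finset.sum_comm]
    simp only [Finset.sum_comm (s := t) (t := Finset.range N)]
    rw [Finset.sum_comm]
    refine Finset.sum_congr rfl fun m _ => Finset.sum_congr rfl fun α _ =>
      Finset.sum_congr rfl fun β _ => ?_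
    ring
  rw [hsum]
  calc _ ≤ ∑ m ∈ Finset.range N, ‖T‖ * (‖D m s h‖ * ‖D m t k‖) := by
        refine norm_sum_le_of_le _ fun m _ => (norm_inner_le_norm _ _).trans ?_
        have := T.le_opNorm (D m s h)
        nlinarith [norm_nonneg (D m t k)]
    _ ≤ ‖T‖ * (√(∑ m ∈ Finset.range N, ‖D m s h‖ ^ 2) *
          √(∑ m ∈ Finset.range N, ‖D m t k‖ ^ 2)) := by
        rw [← Finset.mul_sum]
        gcongr
        exact Real.sum_mul_le_sqrt_mul_sqrt _ _ _
    _ ≤ _ := by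
        rw [mul_assoc]
        gcongr
        · exact hnorm s h hs
        · exact hnorm t k ht

end SchurMultiplier

/-! ### Matrix entries of φ(rS₁, …, rSₙ) and of φ(S₁, …, Sₙ) on polynomials -/

section Evaluation

variable {E : Type*} [NormedAddCommGroup E] [InnerProductSpace ℂ E] {n : ℕ}
variable {A B : Word n → E →L[ℂ] E}

theorem hasSum_inner_clm {X : Type*} [NormedAddCommGroup X] [InnerProductSpace ℂ X]
    {f : ℕ → X →L[ℂ] X} (hf : Summable f) (u v : X) :
    HasSum (fun k => inner ℂ v (f k u)) (inner ℂ v ((∑' k, f k) u)) :=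
  hf.hasSum.mapL (innerSL ℂ v ∘L ContinuousLinearMap.apply ℂ X u)

theorem inner_posPart (r : ℝ) (k : ℕ) (x y : E) (α β : Word n) :
    inner ℂ (tens y (e β)) (posPart A r k (tens x (e α))) = ∑ ω ∈ wordsOfLength n k,
      if β = ω * α then (r : ℂ) ^ ω.length * inner ℂ y (A ω x) else 0 := by
  rw [posPart, sum_apply, inner_sum]
  refine Finset.sum_congr rfl fun ω _ => ?_
  rw [opTens_smul, smul_apply, inner_smul_right, inner_opTens_SWord, mul_ite, mul_zero]

theorem inner_negPart (r : ℝ) (k : ℕ) (x y : E) (α β : Word n) :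
    inner ℂ (tens y (e β)) (negPart B r k (tens x (e α))) = ∑ ω ∈ wordsOfLength n k,
      if α = ω * β then (r : ℂ) ^ ω.length * inner ℂ y (B ω x) else 0 := by
  rw [negPart, sum_apply, inner_sum]
  refine Finset.sum_congr rfl fun ω _ => ?_
  rw [opTens_smul, smul_apply, inner_smul_right, inner_opTens_adjoint_SWord, mul_ite, mul_zero]

/-- The length distance vanishes on the diagonal, so the constant term is not damped. -/
theorem inner_symbolKernel (c : ℂ) (x y : E) (α β : Word n) :
    c ^ lengthDist β α * inner ℂ y (symbolKernel A B β α x) =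
      c ^ lengthDist α β * inner ℂ y (strictKernel B α β x) +
        (if β = α then inner ℂ y (A 1 x) else 0) +
        c ^ lengthDist β α * inner ℂ y (strictKernel A β α x) := by
  rw [symbolKernel, add_apply, add_apply, inner_add_right, inner_add_right, lengthDist_comm α β]
  split_ifs with h
  · subst h
    simp [lengthDist_self]
  · simp [mul_add]

theorem inner_opTens_id (x y : E) (α β : Word n) :
    inner ℂ (tens y (e β)) (opTens (A 1) (.id ℂ (Fock n)) (tens x (e α))) =
      if β = α then inner ℂ y (A 1 x) else 0 := by
  rw [opTens_tens, ContinuousLinearMap.id_apply, inner_tens_e]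

/-- The entries of `φ(rS₁, …, rSₙ)` in the basis of words. -/
theorem inner_phi {r : ℝ}
    (hB : Summable fun k : ℕ => (negPart B r (k + 1) : HTensor E n →L[ℂ] HTensor E n))
    (hA : Summable fun k : ℕ => (posPart A r (k + 1) : HTensor E n →L[ℂ] HTensor E n))
    (x y : E) (α β : Word n) :
    inner ℂ (tens y (e β)) (phi A B r (tens x (e α))) =
      (r : ℂ) ^ lengthDist β α * inner ℂ y (symbolKernel A B β α x) := by
  have h1 := hasSum_inner_clm hB (tens x (e α)) (tens y (e β))
  have h2 := hasSum_inner_clm hA (tens x (e α)) (tens y (e β))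
  simp only [inner_negPart] at h1
  simp only [inner_posPart] at h2
  rw [phi, add_apply, add_apply, inner_add_right, inner_add_right,
    h1.unique (hasSum_strictKernel_graded _ α β), h2.unique (hasSum_strictKernel_graded _ β α),
    inner_symbolKernel, strictKernel_inner, strictKernel_inner, inner_opTens_id]

theorem negTerm_zero (B : Word n → E →L[ℂ] E) : negTerm B 0 = 0 := by
  ext ω
  simp [negTerm]

theorem negTerm_add (B : Word n → E →L[ℂ] E) (p q : HTensor E n) :
    negTerm B (p + q) = negTerm B p + negTerm B q := by
  ext ω
  simp [negTerm]

theorem negTerm_smul (B : Word n → E →L[ℂ] E) (c : ℂ) (q : HTensor E n) :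
    negTerm B (c • q) = c • negTerm B q := by
  ext ω
  simp [negTerm]

theorem posTerm_zero (A : Word n → E →L[ℂ] E) : posTerm A 0 = 0 := by
  ext ω
  simp [posTerm]

theorem posTerm_add (A : Word n → E →L[ℂ] E) (p q : HTensor E n) :
    posTerm A (p + q) = posTerm A p + posTerm A q := by
  ext ω
  simp [posTerm]

theorem posTerm_smul (A : Word n → E →L[ℂ] E) (c : ℂ) (q : HTensor E n) :
    posTerm A (c • q) = c • posTerm A q := by
  ext ω
  simp [posTerm]

/-- S_ω* annihilates e_α as soon as ω is longer than α, so on a polynomial only finitely many terms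
survive and B needs no hypothesis. -/
theorem summable_negTerm (B : Word n → E →L[ℂ] E) {q : HTensor E n} (hq : q ∈ polynomials E n) :
    Summable (negTerm B q) := by
  induction hq using Submodule.span_induction with
  | mem v hv =>
    obtain ⟨x, α, rfl⟩ := hv
    refine summable_of_hasFiniteSupport (Set.Finite.subset
      (Set.Finite.preimage Subtype.val_injective.injOn
        ((Finset.range (α.length + 1)).biUnion (wordsOfLength n)).finite_toSet) ?_)
    intro ω hω
    by_contra hc
    refine hω (eq_of_inner_tens fun y β => ?_)
    rw [negTerm, inner_opTens_adjoint_SWord, if_neg, inner_zero_right]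
    rintro rfl
    refine hc ?_
    simp only [Set.mem_preimage, Finset.mem_coe, Finset.mem_biUnion, Finset.mem_range,
      mem_wordsOfLength, FreeMonoid.length_mul]
    exact ⟨_, by omega, rfl⟩
  | zero =>
    rw [negTerm_zero]
    exact summable_zero
  | add u v _ _ hu hv =>
    rw [negTerm_add]
    exact hu.add hv
  | smul c u _ hu =>
    rw [negTerm_smul]
    exact hu.const_smul c

/-- For fixed α the words ωα are distinct, so the terms are orthogonal and summability reduces to
that of ‖A_ω x‖². -/
theorem summable_posTerm {C : ℝ} (hA : ColumnBounded A C) {q : HTensor E n}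
    (hq : q ∈ polynomials E n) : Summable (posTerm A q) := by
  induction hq using Submodule.span_induction with
  | mem v hv =>
    obtain ⟨x, α, rfl⟩ := hv
    have h := ((orthogonalFamily_embed (E := E) (n := n)).comp
      (γ := {ω : Word n // ω ≠ 1}) (f := fun ω => ω.1 * α)
      (fun ω ω' h => Subtype.ext (mul_right_cancel h))).summable_iff_norm_sq_summable
      (fun ω => A ω.1 x)
    refine (h.2 ((hA.summable x).comp_injective Subtype.val_injective)).congr fun ω => ?_
    rw [posTerm, opTens_tens, SWord_e]
    rfl
  | zero =>
    rw [posTerm_zero]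
    exact summable_zero
  | add u v _ _ hu hv =>
    rw [posTerm_add]
    exact hu.add hv
  | smul c u _ hu =>
    rw [posTerm_smul]
    exact hu.const_smul c

/-- The map `q ↦ φ(S₁, …, Sₙ) q` on polynomials. -/
def phiLinear (A B : Word n → E →L[ℂ] E) {C : ℝ} (hA : ColumnBounded A C) :
    polynomials E n →ₗ[ℂ] HTensor E n where
  toFun q := phiApply A B q
  map_add' p q := by
    simp only [phiApply, Submodule.coe_add, negTerm_add, posTerm_add, Pi.add_apply,
      (summable_negTerm B p.2).tsum_add (summable_negTerm B q.2),
      (summable_posTerm hA p.2).tsum_add (summable_posTerm hA q.2), map_add]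
    abel
  map_smul' c q := by
    simp only [phiApply, Submodule.coe_smul, negTerm_smul, posTerm_smul, Pi.smul_apply,
      (summable_negTerm B q.2).tsum_const_smul, (summable_posTerm hA q.2).tsum_const_smul,
      map_smul, smul_add, RingHom.id_apply]

@[simp] theorem phiLinear_apply {C : ℝ} (hA : ColumnBounded A C) (q : polynomials E n) :
    phiLinear A B hA q = phiApply A B q := rfl

/-- The entries of `φ(S₁, …, Sₙ)` in the basis of words. -/
theorem inner_phiApply {C : ℝ} (hA : ColumnBounded A C) (x y : E) (α β : Word n) :
    inner ℂ (tens y (e β)) (phiApply A B (tens x (e α))) =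
      inner ℂ y (symbolKernel A B β α x) := by
  have h1 : inner ℂ (tens y (e β)) (∑' ω, negTerm B (tens x (e α)) ω) =
      inner ℂ y (strictKernel B α β x) := by
    have h := (summable_negTerm B (tens_e_mem_polynomials x α)).hasSum.mapL
      (innerSL ℂ (tens y (e β)))
    have h' := hasSum_strictKernel (fun ω => inner ℂ y (B ω x)) α β
    rw [show strictKernel (fun ω => inner ℂ y (B ω x)) α β = inner ℂ y (strictKernel B α β x) by
      simpa using strictKernel_inner B 1 x y α β] at h'
    exact h.unique (h'.congr fun s => Finset.sum_congr rfl fun ω _ =>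
      (inner_opTens_adjoint_SWord _ _ _ _ _ _).symm)
  have h2 : inner ℂ (tens y (e β)) (∑' ω, posTerm A (tens x (e α)) ω) =
      inner ℂ y (strictKernel A β α x) := by
    have h := (summable_posTerm hA (tens_e_mem_polynomials x α)).hasSum.mapL
      (innerSL ℂ (tens y (e β)))
    have h' := hasSum_strictKernel (fun ω => inner ℂ y (A ω x)) β α
    rw [show strictKernel (fun ω => inner ℂ y (A ω x)) β α = inner ℂ y (strictKernel A β α x) by
      simpa using strictKernel_inner A 1 x y β α] at h'
    exact h.unique (h'.congr fun s => Finset.sum_congr rfl fun ω _ =>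
      (inner_opTens_SWord _ _ _ _ _ _).symm)
  have h3 := inner_symbolKernel (A := A) (B := B) 1 x y α β
  simp only [one_pow, one_mul] at h3
  rw [phiApply, inner_add_right, inner_add_right, h1, h2, h3, inner_opTens_id]

end Evaluation

/-! ### Contractivity of radial damping -/

section Damping

variable {E : Type*} [NormedAddCommGroup E] [InnerProductSpace ℂ E] {n : ℕ}

/-- If the entries of `P` are those of `T` damped by `r ^ ||β| - |α||`, then `‖P‖ ≤ ‖T‖`. -/
theorem opNorm_le_of_damped {P T : HTensor E n →L[ℂ] HTensor E n} {r : ℝ}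
    (hr : r ∈ Set.Ico (0 : ℝ) 1)
    (h : ∀ (x y : E) (α β : Word n), inner ℂ (tens y (e β)) (P (tens x (e α))) =
      (r : ℂ) ^ lengthDist β α * inner ℂ (tens y (e β)) (T (tens x (e α)))) :
    ‖P‖ ≤ ‖T‖ := by
  refine opNorm_le_of_polynomials (norm_nonneg T) fun p hp q hq => ?_
  obtain ⟨s, f, rfl⟩ := exists_eq_sum_of_mem_polynomials hp
  obtain ⟨t, g, rfl⟩ := exists_eq_sum_of_mem_polynomials hq
  have hr1 : r ^ 2 ≤ 1 := pow_le_one₀ hr.1 hr.2.le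
  -- The Gram identity needs N strictly above every word length involved.
  set N := (s ∪ t).sup FreeMonoid.length + 1 with hN
  have hlen : ∀ α ∈ s ∪ t, α.length < N := fun α hα =>
    Nat.lt_succ_of_le (Finset.le_sup (f := FreeMonoid.length) hα)
  have hw : ∀ α ∈ s ∪ t,
      ∑ m ∈ Finset.range N, poissonVector r α.length m ^ 2 ≤ 1 := by
    intro α hα
    simp only [sq]
    rw [sum_poissonVector hr1 (hlen α hα) (hlen α hα)]
    simp
  refine le_trans (le_of_eq ?_) (norm_schur_le T s t f g N (fun m α => poissonVector r α.length m)
    (fun α hα => hw α (Finset.mem_union_left _ hα))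
    (fun α hα => hw α (Finset.mem_union_right _ hα)))
  simp only [map_sum, sum_inner, inner_sum]
  rw [Finset.sum_comm]
  congr 1
  refine Finset.sum_congr rfl fun β hβ => Finset.sum_congr rfl fun α hα => ?_
  rw [h, sum_poissonVector hr1 (hlen β (Finset.mem_union_right _ hβ))
    (hlen α (Finset.mem_union_left _ hα)), Complex.ofReal_pow]
  rfl

end Damping

/-! ### Radial limits in the strong topology and in norm -/

section RadialLimit

variable {E : Type*} [NormedAddCommGroup E] [InnerProductSpace ℂ E] [CompleteSpace E] {n : ℕ}
variable {A B : Word n → E →L[ℂ] E} {C C' : ℝ}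

theorem _root_.HasSum.adjoint {X : Type*} [NormedAddCommGroup X] [InnerProductSpace ℂ X]
    [CompleteSpace X] {ι : Type*} {f : ι → X →L[ℂ] X} {P : X →L[ℂ] X} (h : HasSum f P) :
    HasSum (fun i => ContinuousLinearMap.adjoint (f i)) (ContinuousLinearMap.adjoint P) :=
  h.map (ContinuousLinearMap.adjoint (𝕜 := ℂ) (E := X) (F := X))
    (ContinuousLinearMap.adjoint (𝕜 := ℂ) (E := X) (F := X)).continuous

theorem tsum_clm_mem {X : Type*} [NormedAddCommGroup X] [InnerProductSpace ℂ X]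
    {f : ℕ → X →L[ℂ] X} (hf : Summable f) {s : Submodule ℂ (X →L[ℂ] X)}
    (hs : IsClosed (s : Set (X →L[ℂ] X))) (h : ∀ k, f k ∈ s) : ∑' k, f k ∈ s :=
  hs.mem_of_tendsto hf.hasSum (Eventually.of_forall fun _ => s.sum_mem fun k _ => h k)

theorem Ico_mem_nhdsLT_one : Set.Ico (0 : ℝ) 1 ∈ 𝓝[<] (1 : ℝ) :=
  Ico_mem_nhdsLT zero_lt_one

/-- By Parseval ‖v_r - u‖² is the sum of (r^d(β) - 1)² ‖c_β(u)‖². Each term tends to 0 and is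
dominated by ‖c_β(u)‖², whatever the growth of the exponents d. -/
theorem tendsto_of_coord_eq {u : HTensor E n} {v : ℝ → HTensor E n} (d : Word n → ℕ)
    (h : ∀ r ∈ Set.Ico (0 : ℝ) 1, ∀ β, coord β (v r) = ((r : ℂ) ^ d β) • coord β u) :
    Tendsto v (𝓝[<] 1) (𝓝 u) := by
  rw [tendsto_iff_norm_sub_tendsto_zero]
  have hsq : Tendsto (fun r => ‖v r - u‖ ^ 2) (𝓝[<] 1) (𝓝 0) := by
    have hu := hasSum_norm_sq_coord u
    have key : Tendsto (fun r : ℝ => ∑' β, (r ^ d β - 1) ^ 2 * ‖coord β u‖ ^ 2) (𝓝[<] 1)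
        (𝓝 (∑' β : Word n, (0 : ℝ))) := by
      refine tendsto_tsum_of_dominated_convergence hu.summable (fun β => ?_) ?_
      · have hc : Continuous fun r : ℝ => (r ^ d β - 1) ^ 2 * ‖coord β u‖ ^ 2 := by fun_prop
        have := (hc.tendsto 1).mono_left (nhdsWithin_le_nhds (s := Set.Iio 1))
        simpa using this
      · filter_upwards [Ico_mem_nhdsLT_one] with r hr β
        rw [Real.norm_of_nonneg (by positivity)]
        refine mul_le_of_le_one_left (by positivity) ?_
        have h0 := pow_nonneg hr.1 (d β)
        have h1 := pow_le_one₀ hr.1 hr.2.le (n := d β)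
        nlinarith
    rw [tsum_zero] at key
    refine key.congr' ?_
    filter_upwards [Ico_mem_nhdsLT_one] with r hr
    rw [← (hasSum_norm_sq_coord (v r - u)).tsum_eq]
    refine tsum_congr fun β => ?_
    have : ((r : ℂ) ^ d β) • coord β u - coord β u = ((r ^ d β - 1 : ℝ) : ℂ) • coord β u := by
      push_cast
      rw [sub_smul, one_smul]
    rw [map_sub, h r hr, this, norm_smul, mul_pow, Complex.norm_real, Real.norm_eq_abs, sq_abs]
  have := hsq.sqrt
  simpa using this

theorem coord_eq_smul_of_inner {u v : HTensor E n} {β : Word n} {c : ℂ}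
    (h : ∀ y : E, inner ℂ (tens y (e β)) v = c * inner ℂ (tens y (e β)) u) :
    coord β v = c • coord β u := by
  refine ext_inner_left ℂ fun y => ?_
  rw [inner_smul_right, inner_coord, inner_coord, h]

theorem summable_negPart (hC : 0 ≤ C')
    (hB : ColumnBounded (fun α => ContinuousLinearMap.adjoint (B α)) C')
    {r : ℝ} (hr : r ∈ Set.Ico (0 : ℝ) 1) :
    Summable (fun k : ℕ => (negPart B r (k + 1) : HTensor E n →L[ℂ] HTensor E n)) := by
  refine (summable_posPart (n := n) hC hB hr).hasSum.adjoint.summable.congr fun k => ?_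
  exact adjoint_posPart B r (k + 1)

theorem phi_mem_discOpSum (hC : 0 ≤ C) (hA : ColumnBounded A C) (hC' : 0 ≤ C')
    (hB : ColumnBounded (fun α => ContinuousLinearMap.adjoint (B α)) C')
    {r : ℝ} (hr : r ∈ Set.Ico (0 : ℝ) 1) : phi A B r ∈ discOpSum E n := by
  refine ⟨∑' k : ℕ, posPart (fun α => ContinuousLinearMap.adjoint (B α)) r (k + 1), ?_,
    -- The constant term is counted in the analytic summand.
    opTens (A 1) (.id ℂ (Fock n)) + ∑' k : ℕ, posPart A r (k + 1), ?_, ?_⟩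
  · exact tsum_clm_mem (summable_posPart hC' hB hr) (Submodule.isClosed_topologicalClosure _)
      fun k => posPart_mem_discOpSpace _ r _
  · refine Submodule.add_mem _ ?_ ?_
    · exact Submodule.le_topologicalClosure _ (Submodule.subset_span
        ⟨A 1, .id ℂ (Fock n), Subalgebra.one_mem _, rfl⟩)
    · exact tsum_clm_mem (summable_posPart hC hA hr) (Submodule.isClosed_topologicalClosure _)
        fun k => posPart_mem_discOpSpace _ r _
  · rw [phi, add_assoc]
    congr 1
    have h := (summable_posPart (n := n) hC' hB hr).hasSum.adjoint
    simp only [adjoint_posPart] at h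
    exact h.tsum_eq

/-- On polynomials, `φ(rS₁, …, rSₙ)` converges to `φ(S₁, …, Sₙ)` as `r → 1`. -/
theorem tendsto_phi_polynomial (hA : ColumnBounded A C)
    (hpos : ∀ r ∈ Set.Ico (0 : ℝ) 1,
      Summable fun k : ℕ => (posPart A r (k + 1) : HTensor E n →L[ℂ] HTensor E n))
    (hneg : ∀ r ∈ Set.Ico (0 : ℝ) 1,
      Summable fun k : ℕ => (negPart B r (k + 1) : HTensor E n →L[ℂ] HTensor E n))
    {q : HTensor E n} (hq : q ∈ polynomials E n) :
    Tendsto (fun r : ℝ => phi A B r q) (𝓝[<] 1) (𝓝 (phiApply A B q)) := by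
  -- Carrying the membership proof along lets the span induction use the linearity of `phiLinear`.
  suffices H : ∃ hq : q ∈ polynomials E n,
      Tendsto (fun r : ℝ => phi A B r q) (𝓝[<] 1) (𝓝 (phiLinear A B hA ⟨q, hq⟩)) by
    obtain ⟨_, h⟩ := H
    exact h
  refine Submodule.span_induction ?_ ?_ ?_ ?_ hq
  · rintro _ ⟨x, α, rfl⟩
    refine ⟨tens_e_mem_polynomials x α, ?_⟩
    refine tendsto_of_coord_eq (fun β => lengthDist β α) fun r hr β => ?_
    refine coord_eq_smul_of_inner fun y => ?_
    rw [inner_phi (hneg r hr) (hpos r hr), phiLinear_apply, inner_phiApply hA]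
  · refine ⟨Submodule.zero_mem _, ?_⟩
    have : (⟨0, Submodule.zero_mem _⟩ : polynomials E n) = 0 := rfl
    simp only [map_zero, this]
    exact tendsto_const_nhds
  · rintro u v - - ⟨hu, hu'⟩ ⟨hv, hv'⟩
    refine ⟨Submodule.add_mem _ hu hv, ?_⟩
    simp only [map_add]
    exact (hu'.add hv').congr' (by rfl) |>.trans (by
      rw [← map_add]
      rfl)
  · rintro c u - ⟨hu, hu'⟩
    refine ⟨Submodule.smul_mem _ c hu, ?_⟩
    have h1 := hu'.const_smul c
    simp only [map_smul]
    rw [← map_smul] at h1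
    exact h1

theorem tendsto_of_norm_le_of_dense {X : Type*} [NormedAddCommGroup X] [NormedSpace ℂ X]
    {ι : Type*} {l : Filter ι} {P : ι → X →L[ℂ] X} {T : X →L[ℂ] X} {M : ℝ} {s : Set X}
    (hs : Dense s) (hP : ∀ᶠ i in l, ‖P i‖ ≤ M) (h : ∀ q ∈ s, Tendsto (fun i => P i q) l (𝓝 (T q)))
    (x : X) : Tendsto (fun i => P i x) l (𝓝 (T x)) := by
  rw [Metric.tendsto_nhds]
  intro ε hε
  -- The absolute value covers a possibly negative M, and the 1 makes division by K legitimate.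
  set K := |M| + ‖T‖ + 1 with hK
  have hKpos : 0 < K := by positivity
  obtain ⟨q, hq, hxq⟩ := Metric.mem_closure_iff.1 (hs x) (ε / (2 * K)) (by positivity)
  filter_upwards [hP, Metric.tendsto_nhds.1 (h q hq) (ε / 2) (by positivity)] with i hi hqi
  rw [dist_eq_norm] at *
  have e1 : P i x - T x = P i (x - q) + (P i q - T q) - T (x - q) := by
    simp only [map_sub]
    abel
  have b1 : ‖P i (x - q)‖ ≤ |M| * ‖x - q‖ :=
    ((P i).le_opNorm _).trans (by gcongr; exact hi.trans (le_abs_self M))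
  have b2 := T.le_opNorm (x - q)
  have b3 : K * ‖x - q‖ < ε / 2 := by
    rw [lt_div_iff₀ (by positivity)] at hxq
    linarith
  have b4 : ‖P i x - T x‖ ≤ ‖P i (x - q)‖ + ‖P i q - T q‖ + ‖T (x - q)‖ := by
    rw [e1]
    exact (norm_sub_le _ _).trans (by gcongr; exact norm_add_le _ _)
  have b5 : |M| * ‖x - q‖ + ‖T‖ * ‖x - q‖ ≤ K * ‖x - q‖ := by
    rw [hK]
    nlinarith [norm_nonneg (x - q)]
  linarith

/-- Strong limits can only lose norm: a vector on which T nearly attains its norm forces ‖P_i‖ to be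
eventually large. The hypothesis gives the opposite bound. -/
theorem tendsto_opNorm_of_tendsto {X : Type*} [NormedAddCommGroup X] [NormedSpace ℂ X]
    {ι : Type*} {l : Filter ι} {P : ι → X →L[ℂ] X} {T : X →L[ℂ] X}
    (hP : ∀ᶠ i in l, ‖P i‖ ≤ ‖T‖) (h : ∀ x, Tendsto (fun i => P i x) l (𝓝 (T x))) :
    Tendsto (fun i => ‖P i‖) l (𝓝 ‖T‖) := by
  refine tendsto_order.2 ⟨fun c hc => ?_, fun c hc => hP.mono fun i hi => hi.trans_lt hc⟩
  rcases lt_or_ge c 0 with h0 | h0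
  · exact Eventually.of_forall fun i => h0.trans_le (norm_nonneg _)
  · obtain ⟨x, hx⟩ := T.exists_mul_lt_of_lt_opNorm h0 hc
    filter_upwards [(h x).norm.eventually_const_lt hx] with i hi
    exact lt_of_mul_lt_mul_right (hi.trans_le ((P i).le_opNorm x)) (norm_nonneg x)

theorem isLUB_opNorm_of_dense {X : Type*} [NormedAddCommGroup X] [NormedSpace ℂ X]
    (T : X →L[ℂ] X) {s : Submodule ℂ X} (hs : Dense (s : Set X)) :
    IsLUB ((fun q => ‖T q‖) '' {q | q ∈ s ∧ ‖q‖ ≤ 1}) ‖T‖ := by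
  constructor
  · rintro _ ⟨q, ⟨-, hq⟩, rfl⟩
    exact (T.le_opNorm q).trans (mul_le_of_le_one_right (norm_nonneg T) hq)
  · intro b hb
    have hb0 : 0 ≤ b := by
      have := hb ⟨0, ⟨s.zero_mem, by simp⟩, rfl⟩
      simpa using this
    refine T.opNorm_le_bound hb0 fun x => ?_
    refine hs.induction (P := fun x => ‖T x‖ ≤ b * ‖x‖) (fun q hq => ?_)
      (isClosed_le (by fun_prop) (by fun_prop)) x
    rcases eq_or_ne q 0 with rfl | hq0
    · simp
    have hpos := norm_pos_iff.2 hq0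
    have := hb ⟨((‖q‖ : ℂ)⁻¹) • q, ⟨s.smul_mem _ hq, by
      rw [norm_smul, norm_inv, Complex.norm_real, norm_norm, inv_mul_cancel₀ hpos.ne']⟩, rfl⟩
    simp only [map_smul, norm_smul, norm_inv, Complex.norm_real, norm_norm] at this
    rwa [inv_mul_le_iff₀ hpos, mul_comm] at this

end RadialLimit

/-! ### From operators to Fourier series and back -/

section FourierRepresentation

variable {E : Type*} [NormedAddCommGroup E] [InnerProductSpace ℂ E] [CompleteSpace E] {n : ℕ}
variable {A B : Word n → E →L[ℂ] E} {C : ℝ} {T : HTensor E n →L[ℂ] HTensor E n}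

/-- The A_α are the coordinates of x ↦ T(x ⊗ 1), and the B_α* those of x ↦ T*(x ⊗ 1), so only the
boundedness of T matters here. -/
theorem wotConvergent_of_isFourierRepr (hF : IsFourierRepr A B T) : WOTConvergent A B := by
  refine ⟨summable_wot_of_inner (V := T ∘L (embed 1).toContinuousLinearMap)
    fun α _ x y => (hF.1 α x y).symm, ?_⟩
  have hB : ∀ α : Word n, α ≠ 1 → ∀ x y : E,
      inner ℂ (tens y (e α)) ((ContinuousLinearMap.adjoint T ∘L
        (embed 1).toContinuousLinearMap) x) = inner ℂ y (ContinuousLinearMap.adjoint (B α) x) := by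
    intro α hα x y
    have h1 := congrArg (starRingEnd ℂ) (hF.2 α hα y x)
    rw [inner_conj_symm, inner_conj_symm] at h1
    rw [ContinuousLinearMap.comp_apply, ContinuousLinearMap.adjoint_inner_right,
      ContinuousLinearMap.adjoint_inner_right, h1]
    rfl
  have h := summable_wot_of_inner hB
  simp only [ContinuousLinearMap.adjoint_adjoint] at h
  exact h

/-- On basis tensors both sides have the entries of `symbolKernel`, and linearity does the rest. -/
theorem phiApply_eq (hT : IsMultiToeplitz T) (hF : IsFourierRepr A B T) (hA : ColumnBounded A C)
    {q : HTensor E n} (hq : q ∈ polynomials E n) : phiApply A B q = T q := by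
  suffices H : ∃ hq : q ∈ polynomials E n, phiLinear A B hA ⟨q, hq⟩ = T q from H.choose_spec
  refine Submodule.span_induction ?_ ?_ ?_ ?_ hq
  · rintro _ ⟨x, α, rfl⟩
    refine ⟨tens_e_mem_polynomials x α, eq_of_inner_tens fun y β => ?_⟩
    rw [phiLinear_apply, inner_phiApply hA, inner_eq_symbolKernel hT hF]
  · exact ⟨Submodule.zero_mem _, by rw [map_zero]; exact map_zero (phiLinear A B hA)⟩
  · rintro u v - - ⟨hu, hu'⟩ ⟨hv, hv'⟩
    refine ⟨Submodule.add_mem _ hu hv, ?_⟩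
    rw [map_add, ← hu', ← hv']
    exact map_add (phiLinear A B hA) ⟨u, hu⟩ ⟨v, hv⟩
  · rintro c u - ⟨hu, hu'⟩
    refine ⟨Submodule.smul_mem _ c hu, ?_⟩
    rw [map_smul, ← hu']
    exact map_smul (phiLinear A B hA) c ⟨u, hu⟩

/-- A formal series that is bounded on polynomials is the Fourier representation of a
multi-Toeplitz operator. -/
theorem exists_isMultiToeplitz_of_bound (hA : ColumnBounded A C) {M : ℝ}
    (hM : ∀ q ∈ polynomials E n, ‖phiApply A B q‖ ≤ M * ‖q‖) :
    ∃ T : HTensor E n →L[ℂ] HTensor E n, IsMultiToeplitz T ∧ IsFourierRepr A B T := by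
  have hd : DenseRange (polynomials E n).subtype := by
    rw [DenseRange, Submodule.coe_subtype, Subtype.range_coe]
    exact dense_polynomials
  have h : ∀ (x y : E) (α β : Word n), inner ℂ (tens y (e β))
      ((phiLinear A B hA).extendOfNorm (polynomials E n).subtype (tens x (e α))) =
      inner ℂ y (symbolKernel A B β α x) := by
    intro x y α β
    -- The bound M is what guarantees that the extension agrees with φ(S₁, …, Sₙ) on polynomials.
    have := LinearMap.extendOfNorm_eq (f := phiLinear A B hA) hd ⟨M, fun q => hM q.1 q.2⟩
      ⟨_, tens_e_mem_polynomials x α⟩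
    rw [Submodule.subtype_apply] at this
    rw [this, phiLinear_apply, inner_phiApply hA]
  exact ⟨_, isMultiToeplitz_of_inner h, isFourierRepr_of_inner h⟩

end FourierRepresentation

end MultiToeplitz

end

open MultiToeplitz in
theorem theorem1p2 {E : Type*} [NormedAddCommGroup E] [InnerProductSpace ℂ E] [CompleteSpace E]
    (n : ℕ) (hn : 1 ≤ n) (A B : Word n → E →L[ℂ] E) :
    ((∃ T : HTensor E n →L[ℂ] HTensor E n, IsMultiToeplitz T ∧ IsFourierRepr A B T) ↔
      (WOTConvergent A B ∧
        BddAbove ((fun r : ℝ => ‖phi A B r‖) '' Set.Ico (0 : ℝ) 1))) ∧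
    -- condition (i) makes the operators in condition (ii) meaningful
    (WOTConvergent A B → ∀ r ∈ Set.Ico (0 : ℝ) 1,
      Summable (fun k : ℕ => (negPart B r (k + 1) : HTensor E n →L[ℂ] HTensor E n)) ∧
      Summable (fun k : ℕ => (posPart A r (k + 1) : HTensor E n →L[ℂ] HTensor E n))) ∧
    ∀ T : HTensor E n →L[ℂ] HTensor E n, IsMultiToeplitz T → IsFourierRepr A B T →
      -- (a)
      (∀ r ∈ Set.Ico (0 : ℝ) 1,
        Summable (fun k : ℕ => negPart B r (k + 1)) ∧
        Summable (fun k : ℕ => posPart A r (k + 1)) ∧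
        phi A B r ∈ discOpSum E n) ∧
      -- (b)
      (∀ h : HTensor E n, Tendsto (fun r : ℝ => phi A B r h) (𝓝[<] 1) (𝓝 (T h))) ∧
      -- (c)
      IsLUB ((fun r : ℝ => ‖phi A B r‖) '' Set.Ico (0 : ℝ) 1) ‖T‖ ∧
      Tendsto (fun r : ℝ => ‖phi A B r‖) (𝓝[<] 1) (𝓝 ‖T‖) ∧
      (∀ q ∈ polynomials E n, Summable (negTerm B q) ∧ Summable (posTerm A q)) ∧
      IsLUB ((fun q : HTensor E n => ‖phiApply A B q‖) ''
        {q | q ∈ polynomials E n ∧ ‖q‖ ≤ 1}) ‖T‖ := by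
  -- The family B enters through its adjoints: B_α B_α* is (B_α*)* B_α*, so the same column estimate
  -- serves both series.
  have hsum : WOTConvergent A B → ∃ C C' : ℝ, 0 ≤ C ∧ 0 ≤ C' ∧ ColumnBounded A C ∧
      ColumnBounded (fun α => ContinuousLinearMap.adjoint (B α)) C' := by
    rintro ⟨h1, h2⟩
    obtain ⟨C, hC, hA⟩ := exists_columnBounded h1
    obtain ⟨C', hC', hB⟩ := exists_columnBounded
      (A := fun α => ContinuousLinearMap.adjoint (B α)) (by simpa using h2)
    exact ⟨C, C', hC, hC', hA, hB⟩
  have hle : ∀ T : HTensor E n →L[ℂ] HTensor E n, IsMultiToeplitz T → IsFourierRepr A B T →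
      ∀ r ∈ Set.Ico (0 : ℝ) 1, ‖phi A B r‖ ≤ ‖T‖ := by
    intro T hT hF r hr
    obtain ⟨C, C', hC, hC', hA, hB⟩ := hsum (wotConvergent_of_isFourierRepr hF)
    refine opNorm_le_of_damped hr fun x y α β => ?_
    rw [inner_phi (summable_negPart hC' hB hr) (summable_posPart hC hA hr),
      inner_eq_symbolKernel hT hF]
  refine ⟨⟨?_, ?_⟩, ?_, ?_⟩
  · rintro ⟨T, hT, hF⟩
    refine ⟨wotConvergent_of_isFourierRepr hF, ‖T‖, ?_⟩
    rintro _ ⟨r, hr, rfl⟩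
    exact hle T hT hF r hr
  · rintro ⟨hW, M, hM⟩
    obtain ⟨C, C', hC, hC', hA, hB⟩ := hsum hW
    -- The uniform bound M on ‖φ(rS₁, …, rSₙ)‖ passes to the pointwise limit on polynomials.
    refine exists_isMultiToeplitz_of_bound hA (M := M) fun q hq => ?_
    have hlim := (tendsto_phi_polynomial hA (fun r hr => summable_posPart hC hA hr)
      (fun r hr => summable_negPart hC' hB hr) hq).norm
    refine le_of_tendsto hlim ?_
    filter_upwards [Ico_mem_nhdsLT_one] with r hr
    exact ((phi A B r).le_opNorm q).trans
      (mul_le_mul_of_nonneg_right (hM ⟨r, hr, rfl⟩) (norm_nonneg q))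
  · intro hW r hr
    obtain ⟨C, C', hC, hC', hA, hB⟩ := hsum hW
    exact ⟨summable_negPart hC' hB hr, summable_posPart hC hA hr⟩
  · intro T hT hF
    obtain ⟨C, C', hC, hC', hA, hB⟩ := hsum (wotConvergent_of_isFourierRepr hF)
    have hev : ∀ᶠ r in 𝓝[<] (1 : ℝ), ‖phi A B r‖ ≤ ‖T‖ := by
      filter_upwards [Ico_mem_nhdsLT_one] with r hr using hle T hT hF r hr
    have hsot : ∀ h : HTensor E n, Tendsto (fun r : ℝ => phi A B r h) (𝓝[<] 1) (𝓝 (T h)) := by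
      refine tendsto_of_norm_le_of_dense dense_polynomials hev fun q hq => ?_
      rw [← phiApply_eq hT hF hA hq]
      exact tendsto_phi_polynomial hA (fun r hr => summable_posPart hC hA hr)
        (fun r hr => summable_negPart hC' hB hr) hq
    have hnorm := tendsto_opNorm_of_tendsto hev hsot
    refine ⟨fun r hr => ⟨summable_negPart hC' hB hr, summable_posPart hC hA hr,
      phi_mem_discOpSum hC hA hC' hB hr⟩, hsot, ⟨?_, ?_⟩, hnorm,
      fun q hq => ⟨summable_negTerm B hq, summable_posTerm hA hq⟩, ?_⟩
    · rintro _ ⟨r, hr, rfl⟩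
      exact hle T hT hF r hr
    -- An upper bound of all the norms also bounds their limit, which is ‖T‖.
    · intro b hb
      refine le_of_tendsto hnorm ?_
      filter_upwards [Ico_mem_nhdsLT_one] with r hr using hb ⟨r, hr, rfl⟩
    · rw [Set.image_congr (g := fun q => ‖T q‖)
        fun q hq => by rw [phiApply_eq hT hF hA hq.1]]
      exact isLUB_opNorm_of_dense T dense_polynomials
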